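/- All graphs are finite, undirected and loopless. For a graph $G$ with vertex set $V$ let $J[u,v]$ be the set of vertices that lie on a chordless (induced) path between $u$ and $v$. A set $C\subseteq V$ is (monophonically) convex if $J[u,v]\subseteq C$ for all $u,v\in C$, and $\mathrm{cl}(X)$ denotes the intersection of all convex sets that contain $X\subseteq V$. For $A,B\subseteq V$ put \[A/B=\{v\in V : \mathrm{cl}(B\cup\{v\})\cap A\neq\emptyset\},\] call a set $X\subseteq V\setminus(A\cup B)$ forbidden if $\mathrm{cl}(X)\cap A\ne\emptyset$ and $\mathrm{cl}(X)\cap B\neq\emptyset$, and let $\mathcal F(A,B)$ be the family of the inclusion-wise minimal forbidden sets. The pre-saturation of $A$ with respect to $B$ is \[\sigma(A,B)=\mathrm{cl}\Big(A/B\cup\bigcup_{X\in\mathcal F(A,B)}\ \bigcap_{x\in X}\mathrm{cl}(A\cup\{x\})\Big),\] and the saturation is $S(A,B)=\bigcup_{i\ge 0}\sigma(A_i,B_i)$, where $A_0=A$, $B_0=B$, $A_{i+1}=\sigma(A_i,B_i)$ and $B_{i+1}=\sigma(B_i,A_i)$. Then: 1. There are a polynomial-time algorithm that, given a graph $G$ and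 two sets $A,B\subseteq V(G)$, computes $\sigma(A,B)$, and a polynomial-time algorithm that, given the same input, computes $S(A,B)$. (Polynomial time is meant on a Turing machine, with $G$ given by its adjacency matrix and sets of vertices by their characteristic vectors.) 2. For every graph $G$ and all $A,B\subseteq V(G)$, every $X\in\mathcal F(A,B)$ has at most $4$ elements. 3. For every graph $G$, every $X\subseteq V(G)$ and every $v\in\mathrm{cl}(X)$ there is $Y\subseteq X$ with $|Y|\le 2$ and $v\in\mathrm{cl}(Y)$; that is, the Carathéodory number of the monophonic convexity of $G$ is at most $2$. If $G$ is connected and not complete, it is equal to $2$. -/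

import Mathlib

namespace Monophonic

variable {V : Type*}

/-- `J[u, v]`: the vertices lying on a chordless (i.e. induced) path between `u` and `v`. -/
def interval (G : SimpleGraph V) (u v : V) : Set V :=
  {w | ∃ p : G.Walk u v, p.IsPath ∧ p.IsChordless ∧ w ∈ p.support}

/-- `J[X]`: the union of the intervals `J[u, v]` over all `u, v ∈ X`. -/
def intervalSet (G : SimpleGraph V) (X : Set V) : Set V :=
  {w | ∃ u ∈ X, ∃ v ∈ X, w ∈ interval G u v}

/-- Monophonically convex sets: `J[C] = C`. -/
def IsMConvex (G : SimpleGraph V) (C : Set V) : Prop :=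
  intervalSet G C = C

/-- The monophonic convex hull: the intersection of all convex sets containing `X`. -/
def hull (G : SimpleGraph V) (X : Set V) : Set V :=
  ⋂₀ {C | IsMConvex G C ∧ X ⊆ C}

/-- Every element of a hull `hull G X` is in the hull of at most `d` elements of `X`. -/
def CaratheodoryBound (G : SimpleGraph V) (d : ℕ) : Prop :=
  ∀ (X : Set V) (v : V), v ∈ hull G X → ∃ Y ⊆ X, v ∈ hull G Y ∧ Y.ncard ≤ d

/-- The Carathéodory number of the monophonic convexity of `G` is `d`. -/
def IsCaratheodoryNumber (G : SimpleGraph V) (d : ℕ) : Prop :=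
  IsLeast {k | CaratheodoryBound G k} d

/-- The shadow `A / B` of `A` with respect to `B`. -/
def shadow (G : SimpleGraph V) (A B : Set V) : Set V :=
  {v | (hull G (B ∪ {v}) ∩ A).Nonempty}

/-- `X` is a forbidden set of `A` and `B`. -/
def IsForbidden (G : SimpleGraph V) (A B X : Set V) : Prop :=
  X ⊆ (A ∪ B)ᶜ ∧ (hull G X ∩ A).Nonempty ∧ (hull G X ∩ B).Nonempty

/-- The family of inclusion-wise minimal forbidden sets of `A` and `B`. -/
def minForbidden (G : SimpleGraph V) (A B : Set V) : Set (Set V) :=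
  {X | Minimal (IsForbidden G A B) X}

/-- The pre-saturation `σ(A, B)` of `A` with respect to `B`. -/
def preSat (G : SimpleGraph V) (A B : Set V) : Set V :=
  hull G (shadow G A B ∪ ⋃ X ∈ minForbidden G A B, ⋂ x ∈ X, hull G (A ∪ {x}))

/-- The pairs `(A_i, B_i)` with `(A_0, B_0) = (A, B)` and
`(A_{i+1}, B_{i+1}) = (σ(A_i, B_i), σ(B_i, A_i))`. -/
def satSeq (G : SimpleGraph V) (A B : Set V) : ℕ → Set V × Set V
  | 0 => (A, B)
  | i + 1 => (preSat G (satSeq G A B i).1 (satSeq G A B i).2,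
      preSat G (satSeq G A B i).2 (satSeq G A B i).1)

/-- The saturation `S(A, B) = ⋃ i, σ(A_i, B_i)` of `A` with respect to `B`. -/
def saturation (G : SimpleGraph V) (A B : Set V) : Set V :=
  ⋃ i : ℕ, preSat G (satSeq G A B i).1 (satSeq G A B i).2

/-- An input of the computational problems: a finite graph on the vertices `0, …, n - 1` and two
sets of vertices. -/
structure Input where
  n : ℕ
  graph : SimpleGraph (Fin n)
  A : Set (Fin n)
  B : Set (Fin n)

/-- An output of the computational problems: a set of vertices among `0, …, n - 1`. -/
abbrev Output : Type := Σ n : ℕ, Set (Fin n)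

open Classical in
/-- The characteristic vector of a set of vertices, as a string of `n` bits. -/
noncomputable def bits {n : ℕ} (S : Set (Fin n)) : List Bool :=
  List.ofFn fun i => decide (i ∈ S)

/-- A characteristic vector followed by the separator `none`. -/
noncomputable def row {n : ℕ} (S : Set (Fin n)) : List (Option Bool) :=
  (bits S).map some ++ [none]

/-- An input is written over the three-letter alphabet `Option Bool` as the `n` rows of the
adjacency matrix of the graph, followed by the characteristic vectors of `A` and of `B`. -/
noncomputable def encodeInput (I : Input) : List (Option Bool) :=
  (List.ofFn fun i => row (I.graph.neighborSet i)).flatten ++ row I.A ++ row I.B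

/-- An output is written as its characteristic vector. -/
noncomputable def encodeOutput (O : Output) : List Bool :=
  bits O.2

/-- The function that maps `G, A, B` to `σ(A, B)`. -/
def preSatFun (I : Input) : Output :=
  ⟨I.n, preSat I.graph I.A I.B⟩

/-- The function that maps `G, A, B` to `S(A, B)`. -/
def saturationFun (I : Input) : Output :=
  ⟨I.n, saturation I.graph I.A I.B⟩

/-- `f` is computed by a (multi-stack) Turing machine within a number of steps that is bounded by
a polynomial in the length of the encoded input. -/
def PolyTimeComputable (f : Input → Output) : Prop :=
  Nonempty (Turing.TM2ComputableInPolyTime encodeInput encodeOutput f)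

/-- The length of the encoding is polynomial in the number of vertices. -/
theorem length_encodeInput (I : Input) :
    (encodeInput I).length = (I.n + 2) * (I.n + 1) := by
  have h : ∀ {n : ℕ} (S : Set (Fin n)), (row S).length = n + 1 := by
    intro n S
    simp [row, bits]
  simp only [encodeInput, List.length_append, List.length_flatten, List.map_ofFn, h]
  simp [Function.comp_def, h]
  ring

theorem bits_injective {n : ℕ} : Function.Injective (bits (n := n)) := by
  intro S T h
  have h2 := List.ofFn_injective h
  ext i
  simpa using congrFun h2 i

theorem encodeOutput_injective : Function.Injective encodeOutput := by
  rintro ⟨n, S⟩ ⟨m, T⟩ h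
  have hn : n = m := by
    have := congrArg List.length h
    simpa [encodeOutput, bits] using this
  subst hn
  have hS : S = T := bits_injective h
  rw [hS]

theorem encodeInput_injective : Function.Injective encodeInput := by
  have hrow : ∀ {n : ℕ} (S : Set (Fin n)), (row S).length = n + 1 := by
    intro n S
    simp [row, bits]
  have hinj : ∀ {n : ℕ} (S T : Set (Fin n)), row S = row T → S = T := by
    intro n S T h
    apply bits_injective
    have h2 := List.append_cancel_right h
    exact List.map_injective_iff.2 (Option.some_injective _) h2
  intro I J h
  have hn : I.n = J.n := by
    have := congrArg List.length h
    rw [length_encodeInput, length_encodeInput] at this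
    by_contra hne
    rcases lt_or_gt_of_ne hne with hlt | hlt <;> nlinarith
  obtain ⟨n, G, A, B⟩ := I
  obtain ⟨m, G', A', B'⟩ := J
  simp only at hn
  subst hn
  simp only [encodeInput] at h
  obtain ⟨h1, hB⟩ := List.append_inj' h (by simp only [hrow])
  obtain ⟨h2, hA⟩ := List.append_inj' h1 (by simp only [hrow])
  have hG : (List.ofFn fun i => row (G.neighborSet i)) =
      List.ofFn fun i => row (G'.neighborSet i) := by
    rw [List.eq_iff_flatten_eq]
    refine ⟨h2, ?_⟩
    simp [List.map_ofFn, Function.comp_def, hrow]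
  have hG2 := List.ofFn_injective hG
  have hGG : G = G' := by
    ext i j
    have := hinj _ _ (congrFun hG2 i)
    exact Set.ext_iff.1 this j
  rw [hGG, hinj _ _ hA, hinj _ _ hB]

end Monophonic

/-! Everything rests on a description of convexity by clique separators: a set is convex iff every
component of its complement has a clique as boundary (`adj_of_mem_boundary_of_isMConvex`,
`isMConvex_of_isClique_boundary_component`). Hence a set K around v that misses X and has a clique
as boundary certifies that v is not in cl(X) (`notMem_hull_of_isClique_boundary`).

Carathéodory number. Let v be in cl(X), let X contain three points, and suppose that no point of X
can be dropped. For x in X let K_x be the component of v outside of cl(X \ {x}). Its boundary is a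
clique, and x is the only point of X inside it. The boundary of K_y lies in K_x or on its boundary,
and no boundary vertex of K_x lies in both K_y and K_z. So every boundary vertex of the component of
v in K_x ∩ K_y ∩ K_z lies on at least two of the three boundaries. Any two such vertices share one
of the cliques, so this component has a clique as boundary; it misses X, a contradiction
(`exists_mem_hull_diff_singleton`). Dropping points one by one leaves at most two. An induced path
on three vertices shows that one point is not enough. A minimal forbidden set is the union of two
such small sets, one for a point of A and one for a point of B, so it has at most 4 elements.

Algorithms. The bound 4 is not needed here. A vertex v lies in the union over the minimal forbidden
sets iff the largest candidate set, all x outside of A and B with v in cl(A ∪ {x}), is forbidden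
(`mem_iUnion_minForbidden_iff`). Hulls and saturations are limits of increasing iterations that are
stationary after 2n rounds (`hullStep_iterate`, `saturation_eq`). All of this is written as formulas
of first-order logic with an operator that iterates a map on pairs of sets 2n times. Each fixed
formula is compiled to a stack machine: every variable has its own stacks, a quantifier is a loop of
n rounds and a fixed point one of 2n rounds, so the running time is a polynomial in n by induction
on the formula (`exists_computedBy`). -/

namespace Monophonic

/-! ### Monophonic convexity and clique separators. -/

open Relation

variable {V : Type*} {G : SimpleGraph V}

/-- The vertices outside of `K` with a neighbor in `K`. -/
def boundary (G : SimpleGraph V) (K : Set V) : Set V :=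
  {a | a ∉ K ∧ ∃ k ∈ K, G.Adj a k}

/-- The vertices that can be reached from `v` inside of `S`. -/
def component (G : SimpleGraph V) (S : Set V) (v : V) : Set V :=
  {u | ReflTransGen (fun a b => G.Adj a b ∧ a ∈ S ∧ b ∈ S) v u}

theorem mem_component_self (S : Set V) (v : V) : v ∈ component G S v :=
  ReflTransGen.refl

theorem mem_component_symm {S : Set V} {u v : V} (h : u ∈ component G S v) :
    v ∈ component G S u :=
  by
  induction h with
  | refl => exact ReflTransGen.refl
  | tail _ h ih => exact ReflTransGen.head ⟨h.1.symm, h.2.2, h.2.1⟩ ih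

theorem mem_component_trans {S : Set V} {u v w : V} (h : u ∈ component G S v)
    (h' : w ∈ component G S u) : w ∈ component G S v :=
  ReflTransGen.trans h h'

theorem component_subset {S : Set V} {v : V} (hv : v ∈ S) : component G S v ⊆ S := by
  intro u hu
  induction hu with
  | refl => exact hv
  | tail _ h _ => exact h.2.2

theorem mem_component_of_adj {S : Set V} {u v w : V} (hu : u ∈ component G S v)
    (huS : u ∈ S) (hw : w ∈ S) (h : G.Adj u w) : w ∈ component G S v :=
  ReflTransGen.tail hu ⟨h, huS, hw⟩

theorem boundary_component_subset {S : Set V} {v : V} (hv : v ∈ S) :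
    boundary G (component G S v) ⊆ Sᶜ := by
  rintro a ⟨ha, k, hk, hak⟩ haS
  exact ha (mem_component_of_adj hk (component_subset hv hk) haS hak.symm)

/-- A set that meets and leaves `S` and is connected has an edge that leaves `S`. -/
theorem exists_adj_of_mem_component {K S : Set V} {a b : V} (h : b ∈ component G K a)
    (ha : a ∈ S) (hb : b ∉ S) :
    ∃ c d, c ∈ K ∧ d ∈ K ∧ c ∈ S ∧ d ∉ S ∧ G.Adj c d := by
  induction h with
  | refl => exact absurd ha hb
  | @tail c d _ h ih =>
    by_cases hc : c ∈ S
    · exact ⟨c, d, h.2.1, h.2.2, hc, hb, h.1⟩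
    · exact ih hc

/-- A walk inside S that starts at v never leaves the component of v, so a component is connected by
walks inside itself. -/
theorem component_component {S : Set V} {v u : V} (h : u ∈ component G S v) :
    u ∈ component G (component G S v) v := by
  induction h with
  | refl => exact ReflTransGen.refl
  | @tail c d h₁ h ih => exact ih.tail ⟨h.1, h₁, h₁.tail h⟩

theorem subset_intervalSet (C : Set V) : C ⊆ intervalSet G C := by
  intro u hu
  refine ⟨u, hu, u, hu, SimpleGraph.Walk.nil, by simp, ?_, by simp⟩
  rw [SimpleGraph.Walk.isChordless_iff_forall_mem_edges]
  intro a b ha hb hab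
  simp only [SimpleGraph.Walk.support_nil, List.mem_singleton] at ha hb
  subst ha hb
  exact absurd hab (G.loopless.irrefl _)

theorem isMConvex_iff {C : Set V} :
    IsMConvex G C ↔ ∀ u ∈ C, ∀ v ∈ C, interval G u v ⊆ C := by
  constructor
  · intro h u hu v hv w hw
    rw [← h]
    exact ⟨u, hu, v, hv, hw⟩
  · intro h
    refine Set.Subset.antisymm ?_ (subset_intervalSet C)
    rintro w ⟨u, hu, v, hv, hw⟩
    exact h u hu v hv hw

theorem isMConvex_sInter {F : Set (Set V)} (h : ∀ C ∈ F, IsMConvex G C) :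
    IsMConvex G (⋂₀ F) := by
  rw [isMConvex_iff]
  intro u hu v hv w hw C hC
  exact isMConvex_iff.1 (h C hC) u (hu C hC) v (hv C hC) hw

theorem isMConvex_hull (X : Set V) : IsMConvex G (hull G X) :=
  isMConvex_sInter fun _ h => h.1

theorem subset_hull (X : Set V) : X ⊆ hull G X :=
  fun _ hx _ hC => hC.2 hx

theorem hull_subset {X C : Set V} (hC : IsMConvex G C) (h : X ⊆ C) : hull G X ⊆ C :=
  fun _ hx => hx C ⟨hC, h⟩

theorem hull_mono {X Y : Set V} (h : X ⊆ Y) : hull G X ⊆ hull G Y :=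
  hull_subset (isMConvex_hull Y) (h.trans (subset_hull Y))

theorem hull_empty : hull G ∅ = ∅ :=
  Set.subset_empty_iff.1 (hull_subset (isMConvex_iff.2 (by simp)) le_rfl)

/-- A shortest walk has no chords. -/
theorem isChordless_of_length_eq_dist {u v : V} (p : G.Walk u v) (hp : p.length = G.dist u v) :
    p.IsChordless := by
  rw [SimpleGraph.Walk.isChordless_iff_forall_mem_edges]
  have key : ∀ i j, i < j → j ≤ p.length → G.Adj (p.getVert i) (p.getVert j) →
      s(p.getVert i, p.getVert j) ∈ p.edges := by
    intro i j hij hj h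
    have h1 := SimpleGraph.dist_le
      ((p.take i).append (SimpleGraph.Walk.cons h (p.drop j)))
    simp only [SimpleGraph.Walk.length_append, SimpleGraph.Walk.length_cons,
      SimpleGraph.Walk.take_length, SimpleGraph.Walk.drop_length] at h1
    -- The detour over the edge has length i + 1 + (length - j), which is less than the distance
    -- unless j = i + 1.
    obtain rfl : j = i + 1 := by omega
    rw [← SimpleGraph.Walk.adj_toSubgraph_iff_mem_edges]
    exact p.toSubgraph_adj_getVert (by omega)
  intro a b ha hb hab
  obtain ⟨i, rfl, hi⟩ := SimpleGraph.Walk.mem_support_iff_exists_getVert.1 ha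
  obtain ⟨j, rfl, hj⟩ := SimpleGraph.Walk.mem_support_iff_exists_getVert.1 hb
  rcases lt_trichotomy i j with h | h | h
  · exact key i j h hj hab
  · subst h
    exact absurd hab (G.loopless.irrefl _)
  · rw [Sym2.eq_swap]
    exact key j i h hi hab.symm

/-- A shortest path between nonadjacent boundary vertices a and b through the component is an
induced path between points of C, and its inner vertices are outside of C. -/
theorem adj_of_mem_boundary_of_isMConvex {C : Set V} (hC : IsMConvex G C) {v a b : V}
    (hv : v ∉ C) (ha : a ∈ boundary G (component G Cᶜ v))
    (hb : b ∈ boundary G (component G Cᶜ v)) (hab : a ≠ b) : G.Adj a b := by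
  by_contra hnadj
  have haC : a ∈ C := not_not.1 (boundary_component_subset hv ha)
  have hbC : b ∈ C := not_not.1 (boundary_component_subset hv hb)
  obtain ⟨haK, k, hk, hak⟩ := ha
  obtain ⟨hbK, l, hl, hbl⟩ := hb
  set K := component G Cᶜ v with hK
  have hKC : K ⊆ Cᶜ := component_subset hv
  let T : Set V := K ∪ {a, b}
  -- The induced subgraph on T, kept on the vertex type V so that its walks map to G by `mapLe`. A
  -- chord in G of a walk inside T is also a chord in H.
  let H : SimpleGraph V :=
    { Adj := fun x y => G.Adj x y ∧ x ∈ T ∧ y ∈ T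
      symm := ⟨fun x y h => ⟨h.1.symm, h.2.2, h.2.1⟩⟩
      loopless := ⟨fun x h => G.loopless.irrefl x h.1⟩ }
  have hle : H ≤ G := fun _ _ h => h.1
  have hreach : ∀ u ∈ K, H.Reachable v u := by
    intro u hu
    have := component_component hu
    induction this with
    | refl => exact SimpleGraph.Reachable.refl _
    | @tail c d _ h ih =>
      refine (ih h.2.1).trans (SimpleGraph.Adj.reachable ?_)
      exact ⟨h.1, Or.inl h.2.1, Or.inl h.2.2⟩
  have hr : H.Reachable a b := by
    have h1 : H.Adj a k := ⟨hak, Or.inr (by simp), Or.inl hk⟩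
    have h2 : H.Adj b l := ⟨hbl, Or.inr (by simp), Or.inl hl⟩
    exact h1.reachable.trans (((hreach k hk).symm.trans (hreach l hl)).trans h2.reachable.symm)
  obtain ⟨p, hp, hlen⟩ := hr.exists_path_of_dist
  have hch := isChordless_of_length_eq_dist p hlen
  have hpos : 0 < p.length := by
    rcases Nat.eq_zero_or_pos p.length with h | h
    · exact absurd (SimpleGraph.Walk.eq_of_length_eq_zero h) hab
    · exact h
  have hT : ∀ w ∈ p.support, w ∈ T := by
    intro w hw
    obtain ⟨i, rfl, hi⟩ := SimpleGraph.Walk.mem_support_iff_exists_getVert.1 hw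
    rcases Nat.eq_zero_or_pos i with rfl | h
    · rw [SimpleGraph.Walk.getVert_zero]
      exact Or.inr (by simp)
    · obtain ⟨j, rfl⟩ : ∃ j, i = j + 1 := ⟨i - 1, by omega⟩
      exact (p.adj_getVert_succ (i := j) (by omega)).2.2
  have h1 := p.adj_getVert_succ (i := 0) hpos
  rw [SimpleGraph.Walk.getVert_zero] at h1
  -- The second vertex of the path is in T, and it is neither a nor, by nonadjacency, b.
  have hmem : p.getVert (0 + 1) ∈ K := by
    rcases hT _ (p.getVert_mem_support (0 + 1)) with h | h | h
    · exact h
    · exact absurd h1.ne (by rw [h]; simp)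
    · rw [Set.mem_singleton_iff] at h
      rw [h] at h1
      exact absurd h1.1 hnadj
  refine hKC hmem (isMConvex_iff.1 hC a haC b hbC ⟨p.mapLe hle, ?_, ?_, ?_⟩)
  · rwa [SimpleGraph.Walk.isPath_mapLe]
  · rw [SimpleGraph.Walk.isChordless_iff_forall_mem_edges] at hch ⊢
    simp only [SimpleGraph.Walk.support_mapLe_eq_support, SimpleGraph.Walk.edges_mapLe_eq_edges]
    exact fun x y hx hy hxy => hch hx hy ⟨hxy, hT x hx, hT y hy⟩
  · rw [SimpleGraph.Walk.support_mapLe_eq_support]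
    exact p.getVert_mem_support _

/-- A path that enters K and leaves it again meets the boundary before and after. These two boundary
vertices are adjacent but not consecutive on the path, which gives a chord. -/
theorem isMConvex_compl_of_isClique_boundary {K : Set V}
    (hK : ∀ a ∈ boundary G K, ∀ b ∈ boundary G K, a ≠ b → G.Adj a b) : IsMConvex G Kᶜ := by
  classical
  rw [isMConvex_iff]
  rintro u hu v hv w ⟨p, hp, hch, hw⟩ hwK
  obtain ⟨i, rfl, hi⟩ := SimpleGraph.Walk.mem_support_iff_exists_getVert.1 hw
  have hprev : ∃ j < i, p.getVert j ∈ boundary G K := by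
    clear hw
    induction i with
    | zero => exact absurd hwK (by simpa using hu)
    | succ i ih =>
      have hadj := p.adj_getVert_succ (i := i) (by omega)
      by_cases h : p.getVert i ∈ K
      · obtain ⟨j, hj, h⟩ := ih (by omega) h
        exact ⟨j, by omega, h⟩
      · exact ⟨i, by omega, h, _, hwK, hadj⟩
  have hnext : ∃ j, i < j ∧ j ≤ p.length ∧ p.getVert j ∈ boundary G K := by
    obtain ⟨d, hd⟩ : ∃ d, d = p.length - i := ⟨_, rfl⟩
    clear hw hprev
    induction d generalizing i with
    | zero =>
      obtain rfl : i = p.length := by omega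
      exact absurd hwK (by simpa using hv)
    | succ d ih =>
      have hadj := p.adj_getVert_succ (i := i) (by omega)
      by_cases h : p.getVert (i + 1) ∈ K
      · obtain ⟨j, hj, h⟩ := ih (i + 1) (by omega) h (by omega)
        exact ⟨j, by omega, h⟩
      · exact ⟨i + 1, by omega, by omega, h, _, hwK, hadj.symm⟩
  obtain ⟨j, hj, hjK⟩ := hprev
  obtain ⟨l, hl, hlp, hlK⟩ := hnext
  have hinj := hp.getVert_injOn
  have hne : p.getVert j ≠ p.getVert l := by
    intro h
    have := hinj (show j ≤ p.length by omega) (show l ≤ p.length by omega) h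
    omega
  have hedge := hch.mem_edges (p.getVert_mem_support j) (p.getVert_mem_support l)
    (hK _ hjK _ hlK hne)
  -- An edge of the path joins positions m and m + 1, whereas j < i < l.
  rw [← SimpleGraph.Walk.adj_toSubgraph_iff_mem_edges, SimpleGraph.Walk.toSubgraph_adj_iff] at hedge
  obtain ⟨m, hm, hml⟩ := hedge
  rw [Sym2.eq_iff] at hm
  rcases hm with ⟨h1, h2⟩ | ⟨h1, h2⟩
  · have e1 := hinj (show m ≤ p.length by omega) (show j ≤ p.length by omega) h1
    have e2 := hinj (show m + 1 ≤ p.length by omega) (show l ≤ p.length by omega) h2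
    omega
  · have e1 := hinj (show m ≤ p.length by omega) (show l ≤ p.length by omega) h1
    have e2 := hinj (show m + 1 ≤ p.length by omega) (show j ≤ p.length by omega) h2
    omega

/-- C is the intersection of the complements of the components of its complement, and each of these
is convex. -/
theorem isMConvex_of_isClique_boundary_component {C : Set V}
    (h : ∀ v ∉ C, ∀ a ∈ boundary G (component G Cᶜ v), ∀ b ∈ boundary G (component G Cᶜ v),
      a ≠ b → G.Adj a b) : IsMConvex G C := by
  have hC : C = ⋂₀ {D | ∃ v ∉ C, D = (component G Cᶜ v)ᶜ} := by
    ext u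
    constructor
    · rintro hu _ ⟨v, hv, rfl⟩ huv
      exact component_subset hv huv hu
    · intro hu
      by_contra huC
      exact hu _ ⟨u, huC, rfl⟩ (mem_component_self _ _)
  rw [hC]
  apply isMConvex_sInter
  rintro _ ⟨v, hv, rfl⟩
  exact isMConvex_compl_of_isClique_boundary (h v hv)

theorem notMem_hull_of_isClique_boundary {K X : Set V} {v : V} (hv : v ∈ K)
    (hK : ∀ a ∈ boundary G K, ∀ b ∈ boundary G K, a ≠ b → G.Adj a b) (hX : ∀ x ∈ X, x ∉ K) :
    v ∉ hull G X :=
  fun h => hull_subset (isMConvex_compl_of_isClique_boundary hK) hX h hv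

/-! ### The Carathéodory number and minimal forbidden sets. -/

/-- Every vertex on the boundary of a component of the complement of `hull G Y` reaches `Y` on the
other side of the boundary. -/
theorem exists_mem_component_of_mem_boundary {Y : Set V} {v q : V} (hv : v ∉ hull G Y)
    (hq : q ∈ boundary G (component G (hull G Y)ᶜ v)) :
    ∃ y ∈ Y, y ∈ component G
      {u | u = q ∨ u ∉ component G (hull G Y)ᶜ v ∧ u ∉ boundary G (component G (hull G Y)ᶜ v)}
      q := by
  by_contra! hcon
  set K := component G (hull G Y)ᶜ v with hKdef
  set S : Set V := {u | u = q ∨ u ∉ K ∧ u ∉ boundary G K} with hS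
  have hqS : q ∈ S := Or.inl rfl
  have hqY : q ∈ hull G Y := not_not.1 (boundary_component_subset hv hq)
  have hsub : ∀ a ∈ boundary G (K ∪ component G S q), a ∈ boundary G K := by
    rintro a ⟨ha, k, hk, hak⟩
    rw [Set.mem_union, not_or] at ha
    rcases hk with hk | hk
    · exact ⟨ha.1, k, hk, hak⟩
    · by_contra haK
      exact ha.2 (mem_component_of_adj hk (component_subset hqS hk) (Or.inr ⟨ha.1, haK⟩) hak.symm)
  refine notMem_hull_of_isClique_boundary (K := K ∪ component G S q) (v := q)
    (Or.inr (mem_component_self _ _)) ?_ ?_ hqY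
  · intro a ha b hb hab
    exact adj_of_mem_boundary_of_isMConvex (isMConvex_hull Y) hv (hsub a ha) (hsub b hb) hab
  · rintro y hy (h | h)
    · exact component_subset hv h (subset_hull Y hy)
    · exact hcon y hy h

/-- Here kᵢ stands for lying in the i-th of three sets and qᵢ for lying on its boundary. Lying on
exactly one boundary is excluded by the nᵢ, and on none by the last hypothesis. -/
theorem two_of_three_of_or {k₁ k₂ k₃ q₁ q₂ q₃ : Prop} (o₁ : k₁ ∨ q₁) (o₂ : k₂ ∨ q₂)
    (o₃ : k₃ ∨ q₃) (n₁ : q₁ → k₂ → ¬ k₃) (n₂ : q₂ → k₁ → ¬ k₃) (n₃ : q₃ → k₁ → ¬ k₂)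
    (h : ¬ (k₁ ∧ k₂ ∧ k₃)) : (q₁ ∧ q₂) ∨ (q₁ ∧ q₃) ∨ (q₂ ∧ q₃) := by
  tauto

/-- Two pairs of indices out of three have an index in common, so a and b share a clique. -/
theorem adj_of_mem_two_of_three {Q₁ Q₂ Q₃ : Set V}
    (c₁ : ∀ a ∈ Q₁, ∀ b ∈ Q₁, a ≠ b → G.Adj a b) (c₂ : ∀ a ∈ Q₂, ∀ b ∈ Q₂, a ≠ b → G.Adj a b)
    (c₃ : ∀ a ∈ Q₃, ∀ b ∈ Q₃, a ≠ b → G.Adj a b) {a b : V}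
    (ha : (a ∈ Q₁ ∧ a ∈ Q₂) ∨ (a ∈ Q₁ ∧ a ∈ Q₃) ∨ (a ∈ Q₂ ∧ a ∈ Q₃))
    (hb : (b ∈ Q₁ ∧ b ∈ Q₂) ∨ (b ∈ Q₁ ∧ b ∈ Q₃) ∨ (b ∈ Q₂ ∧ b ∈ Q₃)) (hab : a ≠ b) :
    G.Adj a b := by
  have d₁ := c₁ a
  have d₂ := c₂ a
  have d₃ := c₃ a
  clear c₁ c₂ c₃
  have e₁ := fun h => d₁ h b
  have e₂ := fun h => d₂ h b
  have e₃ := fun h => d₃ h b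
  clear d₁ d₂ d₃
  tauto

/-- If no point could be dropped, the component of v in the intersection of three sets `K x` would
separate v from X by a clique. -/
theorem exists_mem_hull_diff_singleton {X : Set V} {v x₁ x₂ x₃ : V} (hv : v ∈ hull G X)
    (h₁ : x₁ ∈ X) (h₂ : x₂ ∈ X) (h₃ : x₃ ∈ X) (h₁₂ : x₁ ≠ x₂) (h₁₃ : x₁ ≠ x₃) (h₂₃ : x₂ ≠ x₃) :
    ∃ x ∈ X, v ∈ hull G (X \ {x}) := by
  by_contra! hcon
  let K : V → Set V := fun x => component G (hull G (X \ {x}))ᶜ v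
  have hvK : ∀ x, v ∈ K x := fun x => mem_component_self _ _
  have hclique : ∀ x ∈ X, ∀ a ∈ boundary G (K x), ∀ b ∈ boundary G (K x), a ≠ b → G.Adj a b :=
    fun x hx a ha b hb hab =>
      adj_of_mem_boundary_of_isMConvex (isMConvex_hull _) (hcon x hx) ha hb hab
  have havoid : ∀ x ∈ X, ∀ y ∈ X, y ≠ x → y ∉ K x :=
    fun x hx y hy hyx h => component_subset (hcon x hx) h (subset_hull _ ⟨hy, hyx⟩)
  -- Otherwise `K x` misses all of X and certifies that v is not in the hull.
  have hmem : ∀ x ∈ X, x ∈ K x := by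
    intro x hx
    by_contra hxK
    refine notMem_hull_of_isClique_boundary (hvK x) (hclique x hx) ?_ hv
    intro y hy
    by_cases hyx : y = x
    · rwa [hyx]
    · exact havoid x hx y hy hyx
  -- The connected set `K x` contains v, which is in `K y`, and x, which is not. So it contains a
  -- boundary vertex d of `K y`, and all the others are adjacent to d.
  have hcross : ∀ x ∈ X, ∀ y ∈ X, x ≠ y → boundary G (K y) ⊆ K x ∪ boundary G (K x) := by
    intro x hx y hy hxy q hq
    obtain ⟨c, d, hc, hd, hcS, hdS, hcd⟩ := exists_adj_of_mem_component (S := K y)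
      (component_component (hmem x hx)) (hvK y) (havoid y hy x hx hxy)
    by_cases hqd : q = d
    · subst hqd
      exact Or.inl hd
    · have := hclique y hy q hq d ⟨hdS, c, hcS, hcd.symm⟩ hqd
      by_cases hqx : q ∈ K x
      · exact Or.inl hqx
      · exact Or.inr ⟨hqx, d, hd, this⟩
  -- From q some w in X \ {x} is reached without meeting `K x` or other boundary vertices of `K x`.
  -- By `hcross` this walk cannot leave `K t` if q is in `K t`, so w = t. This cannot hold for both
  -- y and z.
  have hnot : ∀ x ∈ X, ∀ y ∈ X, ∀ z ∈ X, x ≠ y → x ≠ z → y ≠ z →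
      ∀ q ∈ boundary G (K x), q ∈ K y → q ∉ K z := by
    intro x hx y hy z hz hxy hxz hyz q hq hqy hqz
    obtain ⟨w, hw, hwq⟩ := exists_mem_component_of_mem_boundary (hcon x hx) hq
    have hgen : ∀ t ∈ X, x ≠ t → q ∈ K t → w = t := by
      intro t ht hxt hqt
      by_contra hwt
      obtain ⟨c, d, hc, hd, hcS, hdS, hcd⟩ := exists_adj_of_mem_component (S := K t) hwq hqt
        (havoid t ht w hw.1 hwt)
      have hdq : d ≠ q := fun h => hdS (h ▸ hqt)
      rcases hd with hd | hd
      · exact hdq hd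
      · rcases hcross x hx t ht hxt ⟨hdS, c, hcS, hcd.symm⟩ with h | h
        · exact hd.1 h
        · exact hd.2 h
    exact hyz ((hgen y hy hxy hqy).symm.trans (hgen z hz hxz hqz))
  let S : Set V := {u | u ∈ K x₁ ∧ u ∈ K x₂ ∧ u ∈ K x₃}
  have hvS : v ∈ S := ⟨hvK _, hvK _, hvK _⟩
  have hS : component G S v ⊆ S := component_subset hvS
  have htwo : ∀ a ∈ boundary G (component G S v),
      (a ∈ boundary G (K x₁) ∧ a ∈ boundary G (K x₂)) ∨
      (a ∈ boundary G (K x₁) ∧ a ∈ boundary G (K x₃)) ∨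
      (a ∈ boundary G (K x₂) ∧ a ∈ boundary G (K x₃)) := by
    intro a ha
    have haS : ¬ (a ∈ K x₁ ∧ a ∈ K x₂ ∧ a ∈ K x₃) := boundary_component_subset hvS ha
    obtain ⟨_, k, hk, hak⟩ := ha
    have hor : ∀ x, k ∈ K x → a ∈ K x ∨ a ∈ boundary G (K x) := by
      intro x hkx
      by_cases h : a ∈ K x
      · exact Or.inl h
      · exact Or.inr ⟨h, k, hkx, hak⟩
    have o₁ := hor x₁ (hS hk).1
    have o₂ := hor x₂ (hS hk).2.1
    have o₃ := hor x₃ (hS hk).2.2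
    have n₁ := hnot x₁ h₁ x₂ h₂ x₃ h₃ h₁₂ h₁₃ h₂₃ a
    have n₂ := hnot x₂ h₂ x₁ h₁ x₃ h₃ h₁₂.symm h₂₃ h₁₃ a
    have n₃ := hnot x₃ h₃ x₁ h₁ x₂ h₂ h₁₃.symm h₂₃.symm h₁₂ a
    exact two_of_three_of_or o₁ o₂ o₃ n₁ n₂ n₃ haS
  refine notMem_hull_of_isClique_boundary (K := component G S v) (mem_component_self S v) ?_ ?_ hv
  · exact fun a ha b hb => adj_of_mem_two_of_three (fun a ha b => hclique x₁ h₁ a ha b)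
      (fun a ha b => hclique x₂ h₂ a ha b) (fun a ha b => hclique x₃ h₃ a ha b)
      (htwo a ha) (htwo b hb)
  -- Every x in X differs from x₁ or from x₂, and so is outside of `K x₁` or of `K x₂`.
  · intro x hx hxS
    have := hS hxS
    by_cases h : x = x₁
    · exact havoid x₂ h₂ x hx (h ▸ h₁₂) this.2.1
    · exact havoid x₁ h₁ x hx h this.1

theorem caratheodoryBound_two [Finite V] (G : SimpleGraph V) : CaratheodoryBound G 2 := by
  intro X v hv
  obtain ⟨n, hn⟩ : ∃ n, X.ncard = n := ⟨_, rfl⟩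
  induction n using Nat.strong_induction_on generalizing X with
  | _ n ih =>
    by_cases h2 : X.ncard ≤ 2
    · exact ⟨X, le_rfl, hv, h2⟩
    · obtain ⟨a, b, c, ha, hb, hc, hab, hac, hbc⟩ :=
        (Set.two_lt_ncard_iff (Set.toFinite X)).1 (not_le.1 h2)
      obtain ⟨x, hx, hvx⟩ := exists_mem_hull_diff_singleton hv ha hb hc hab hac hbc
      obtain ⟨Y, hY, hY'⟩ := ih _
        (hn ▸ Set.ncard_sdiff_singleton_lt_of_mem hx (Set.toFinite X)) (X \ {x}) hvx rfl
      exact ⟨Y, hY.trans Set.sdiff_subset, hY'⟩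

/-- If c were outside of the hull, a and b would both be boundary vertices of its component and
hence adjacent. -/
theorem mem_hull_pair {a b c : V} (hac : G.Adj a c) (hcb : G.Adj c b) (hab : a ≠ b)
    (hn : ¬ G.Adj a b) : c ∈ hull G {a, b} := by
  by_contra hc
  have hb : ∀ x ∈ ({a, b} : Set V), G.Adj x c →
      x ∈ boundary G (component G (hull G {a, b})ᶜ c) := fun x hx h =>
    ⟨fun h' => component_subset hc h' (subset_hull _ hx), c, mem_component_self _ _, h⟩
  exact hn (adj_of_mem_boundary_of_isMConvex (isMConvex_hull _) hc (hb a (by simp) hac)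
    (hb b (by simp) hcb.symm) hab)

theorem hull_singleton (a : V) : hull G {a} = {a} := by
  refine Set.Subset.antisymm (hull_subset ?_ le_rfl) (subset_hull _)
  rw [isMConvex_iff]
  rintro u hu v hv w ⟨p, hp, -, hw⟩
  rw [Set.mem_singleton_iff] at hu hv
  subst hu hv
  obtain rfl := SimpleGraph.Walk.eq_nil_iff_nil.2 (SimpleGraph.Walk.isPath_iff_nil.1 hp)
  simpa using hw

/-- A walk from a to a vertex b not adjacent to it has an edge that leaves the closed neighborhood
of a. -/
theorem exists_adj_adj_not_adj (hG : G.Connected) (hne : G ≠ ⊤) :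
    ∃ a b c, G.Adj a c ∧ G.Adj c b ∧ a ≠ b ∧ ¬ G.Adj a b := by
  obtain ⟨a, b, hab, hn⟩ : ∃ a b, a ≠ b ∧ ¬ G.Adj a b := by
    by_contra! h
    exact hne (by ext a b; exact ⟨fun h => h.ne, h a b⟩)
  obtain ⟨p⟩ := hG.preconnected a b
  have hb : b ∈ component G Set.univ a := by
    clear hn hab
    induction p with
    | nil => exact mem_component_self _ _
    | cons h _ ih =>
      exact mem_component_trans
        (mem_component_of_adj (mem_component_self _ _) trivial trivial h) ih
  obtain ⟨c, d, -, -, hc, hd, hcd⟩ := exists_adj_of_mem_component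
    (S := {x | x = a ∨ G.Adj a x}) hb (Or.inl rfl) (by simp [hab.symm, hn])
  simp only [Set.mem_ofPred_eq, not_or] at hc hd
  rcases hc with rfl | hc
  · exact absurd hcd hd.2
  · exact ⟨a, d, c, hc, hcd, Ne.symm hd.1, hd.2⟩

/-- The middle vertex of an induced path on three vertices is in the hull of the two ends, but the
hull of at most one of them contains nothing new. -/
theorem isCaratheodoryNumber_two [Finite V] (hG : G.Connected) (hne : G ≠ ⊤) :
    IsCaratheodoryNumber G 2 := by
  refine ⟨caratheodoryBound_two G, fun k hk => ?_⟩
  by_contra! hlt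
  obtain ⟨a, b, c, hac, hcb, hab, hn⟩ := exists_adj_adj_not_adj hG hne
  obtain ⟨Y, hY, hc, hcard⟩ := hk _ _ (mem_hull_pair hac hcb hab hn)
  rcases (Set.ncard_le_one_iff_eq (Set.toFinite Y)).1 (by omega) with rfl | ⟨y, rfl⟩
  · simp [hull_empty] at hc
  · rw [hull_singleton, Set.mem_singleton_iff] at hc
    subst hc
    rcases hY (Set.mem_singleton c) with h | h
    · exact hac.ne h.symm
    · exact hcb.ne h

/-- Two points of X suffice to generate a point of A and two for a point of B. Their union is
forbidden, so it is X by minimality. -/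
theorem ncard_le_four_of_mem_minForbidden [Finite V] (G : SimpleGraph V) (A B X : Set V)
    (hX : X ∈ minForbidden G A B) : X.ncard ≤ 4 := by
  obtain ⟨⟨hsub, ⟨a, haX, haA⟩, ⟨b, hbX, hbB⟩⟩, hmin⟩ := hX
  obtain ⟨Y, hY, haY, hYc⟩ := caratheodoryBound_two G X a haX
  obtain ⟨Z, hZ, hbZ, hZc⟩ := caratheodoryBound_two G X b hbX
  have hle : X ⊆ Y ∪ Z := hmin
    ⟨(Set.union_subset hY hZ).trans hsub, ⟨a, hull_mono Set.subset_union_left haY, haA⟩,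
      ⟨b, hull_mono Set.subset_union_right hbZ, hbB⟩⟩ (Set.union_subset hY hZ)
  calc X.ncard ≤ (Y ∪ Z).ncard := Set.ncard_le_ncard hle (Set.toFinite _)
    _ ≤ Y.ncard + Z.ncard := Set.ncard_union_le _ _
    _ ≤ 4 := by omega

end Monophonic

/-! ### Hulls and saturations as iterations of polynomial length. -/

namespace Monophonic

open Relation

section Iterate

/-- Iterating an inflationary function stabilizes within as many steps as the order is high. -/
theorem isFixedPt_iterate_of_le {α : Type*} [PartialOrder α] (μ : α → ℕ) (hμ : StrictMono μ)
    (m : ℕ) (hm : ∀ a, μ a ≤ m) (F : α → α) (hF : ∀ a, a ≤ F a) (a : α) :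
    F (F^[m] a) = F^[m] a := by
  by_contra hne
  have hlt : ∀ k ≤ m, F^[k] a < F^[k + 1] a := by
    intro k hk
    rw [Function.iterate_succ_apply']
    -- If the sequence stops growing at some k ≤ m, it is constant from there on and the m-th
    -- iterate is fixed too.
    refine lt_of_le_of_ne (hF _) fun h => hne ?_
    obtain ⟨d, rfl⟩ := Nat.exists_eq_add_of_le' hk
    rw [Function.iterate_add_apply, Function.iterate_fixed h.symm]
    exact h.symm
  have hk : ∀ k ≤ m + 1, k ≤ μ (F^[k] a) := by
    intro k
    induction k with
    | zero => simp
    | succ k ih =>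
      intro h
      have h1 := ih (by omega)
      have h2 := hμ (hlt k (by omega))
      omega
  have h1 := hk (m + 1) le_rfl
  have h2 := hm (F^[m + 1] a)
  omega

theorem iterate_induction {α : Type*} (P : α → Prop) (F : α → α) (h : ∀ a, P a → P (F a))
    (a : α) (ha : P a) (k : ℕ) : P (F^[k] a) := by
  induction k with
  | zero => exact ha
  | succ k ih =>
    rw [Function.iterate_succ_apply']
    exact h _ ih

variable {n : ℕ}

/-- Already n rounds would do; 2n is the number needed for pairs of sets, so that one operator
serves both. -/
theorem isFixedPt_iterate_set (F : Set (Fin n) → Set (Fin n)) (hF : ∀ S, S ⊆ F S)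
    (S : Set (Fin n)) : F (F^[2 * n] S) = F^[2 * n] S := by
  refine isFixedPt_iterate_of_le Set.ncard
    (fun S T h => Set.ncard_lt_ncard h (Set.toFinite T)) _ (fun S => ?_) F hF S
  have := Set.ncard_le_card S
  simp only [Nat.card_eq_fintype_card, Fintype.card_fin] at this
  omega

theorem isFixedPt_iterate_set_prod (F : Set (Fin n) × Set (Fin n) → Set (Fin n) × Set (Fin n))
    (hF : ∀ S, S ≤ F S) (S : Set (Fin n) × Set (Fin n)) : F (F^[2 * n] S) = F^[2 * n] S := by
  refine isFixedPt_iterate_of_le (fun S => S.1.ncard + S.2.ncard) (fun S T h => ?_) _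
    (fun S => ?_) F hF S
  · have h1 := Set.ncard_le_ncard h.le.1 (Set.toFinite T.1)
    have h2 := Set.ncard_le_ncard h.le.2 (Set.toFinite T.2)
    by_contra! hle
    refine h.ne (Prod.ext ?_ ?_)
    · exact Set.eq_of_subset_of_ncard_le h.le.1 (by omega) (Set.toFinite _)
    · exact Set.eq_of_subset_of_ncard_le h.le.2 (by omega) (Set.toFinite _)
  · have h1 := Set.ncard_le_card S.1
    have h2 := Set.ncard_le_card S.2
    simp only [Nat.card_eq_fintype_card, Fintype.card_fin] at h1 h2
    omega

end Iterate

section Hull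

variable {n : ℕ} (G : SimpleGraph (Fin n))

/-- One step in the computation of the vertices that are reached from `y` by paths whose inner
vertices are neither in `C` nor adjacent to `z`. -/
def reachStep (C : Set (Fin n)) (y z : Fin n) (R : Set (Fin n)) : Set (Fin n) :=
  {u | u ∈ R ∨ G.Adj y u ∨ ∃ r, r ∈ R ∧ r ∉ C ∧ ¬ G.Adj r z ∧ G.Adj r u}

/-- One step in the computation of the convex hull of `X`. -/
def hullStep (X C : Set (Fin n)) : Set (Fin n) :=
  {w | w ∈ X ∨ w ∈ C ∨ w ∉ C ∧ ∃ y z, y ∈ C ∧ z ∈ C ∧ y ≠ z ∧ ¬ G.Adj y z ∧ G.Adj z w ∧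
    w ∈ (reachStep G C y z)^[2 * n] ∅}

variable {G}

theorem reachStep_iterate_closed {C : Set (Fin n)} {y z u : Fin n}
    (h : G.Adj y u ∨ ∃ r, r ∈ (reachStep G C y z)^[2 * n] ∅ ∧ r ∉ C ∧ ¬ G.Adj r z ∧ G.Adj r u) :
    u ∈ (reachStep G C y z)^[2 * n] ∅ := by
  rw [← isFixedPt_iterate_set (reachStep G C y z) (fun S x hx => Or.inl hx)]
  exact Or.inr h

/-- Every vertex that a step of the computation adds is in every convex set. -/
theorem hullStep_subset_hull {X C : Set (Fin n)} (hC : C ⊆ hull G X) :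
    hullStep G X C ⊆ hull G X := by
  rintro w (hw | hw | ⟨hwC, y, z, hy, hz, hyz, hnadj, hzw, hw⟩)
  · exact subset_hull X hw
  · exact hC hw
  -- Invariant of the search from y: the component of u outside of the hull has a boundary vertex
  -- distinct from z and not adjacent to z. If w is outside of the hull, z is on that boundary as
  -- well, which contradicts the clique property.
  · have key : ∀ u ∈ (reachStep G C y z)^[2 * n] ∅, u ∉ hull G X →
        ∃ s ∈ boundary G (component G (hull G X)ᶜ u), s ≠ z ∧ ¬ G.Adj s z := by
      refine iterate_induction (P := fun R : Set (Fin n) => ∀ u ∈ R, u ∉ hull G X →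
        ∃ s ∈ boundary G (component G (hull G X)ᶜ u), s ≠ z ∧ ¬ G.Adj s z) _ ?_ _ (by simp) _
      rintro R ih u (hu | hu | ⟨r, hr, hrC, hrz, hru⟩) hun
      · exact ih u hu hun
      · exact ⟨y, ⟨fun h => component_subset hun h (hC hy), u, mem_component_self _ _, hu⟩,
          hyz, hnadj⟩
      · by_cases hrX : r ∈ hull G X
        · exact ⟨r, ⟨fun h => component_subset hun h hrX, u, mem_component_self _ _, hru⟩,
            fun h => hrC (h ▸ hz), hrz⟩
        · obtain ⟨s, ⟨hs, k, hk, hsk⟩, hs'⟩ := ih r hr hrX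
          have hur : r ∈ component G (hull G X)ᶜ u :=
            mem_component_of_adj (mem_component_self _ _) hun hrX hru.symm
          exact ⟨s, ⟨fun h => hs (mem_component_trans (mem_component_symm hur) h), k,
            mem_component_trans hur hk, hsk⟩, hs'⟩
    by_contra hwX
    obtain ⟨s, hs, hsz, hn⟩ := key w hw hwX
    exact hn (adj_of_mem_boundary_of_isMConvex (isMConvex_hull X) hwX hs
      ⟨fun h => component_subset hwX h (hC hz), w, mem_component_self _ _, hzw⟩ hsz)

/-- If a component of the complement had nonadjacent boundary vertices y and z, the search from y
would find a neighbor of z in that component, and C would grow. -/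
theorem isMConvex_of_hullStep_eq {X C : Set (Fin n)} (h : hullStep G X C = C) :
    IsMConvex G C := by
  apply isMConvex_of_isClique_boundary_component
  intro v hv y hy z hz hyz
  by_contra hnadj
  have hyC : y ∈ C := not_not.1 (boundary_component_subset hv hy)
  have hzC : z ∈ C := not_not.1 (boundary_component_subset hv hz)
  obtain ⟨-, k, hk, hyk⟩ := hy
  obtain ⟨-, l, hl, hzl⟩ := hz
  -- As C does not grow, the search meets no neighbor of z outside of C. So it is never blocked on
  -- the walk from k to l and arrives at l, which is such a neighbor.
  have hno : ∀ w ∉ C, w ∈ (reachStep G C y z)^[2 * n] ∅ → ¬ G.Adj z w := by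
    intro w hw hwR hzw
    refine hw ?_
    rw [← h]
    exact Or.inr (Or.inr ⟨hw, y, z, hyC, hzC, hyz, hnadj, hzw, hwR⟩)
  have hkl : l ∈ component G Cᶜ k := mem_component_trans (mem_component_symm hk) hl
  have hkC : k ∉ C := component_subset hv hk
  have hR : l ∈ (reachStep G C y z)^[2 * n] ∅ := by
    clear hl hzl
    induction hkl with
    | refl => exact reachStep_iterate_closed (Or.inl hyk)
    | tail _ h ih =>
      exact reachStep_iterate_closed (Or.inr ⟨_, ih, h.2.1, fun h' => hno _ h.2.1 ih h'.symm, h.1⟩)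
  exact hno l (component_subset hv hl) hR hzl

theorem hullStep_iterate (X : Set (Fin n)) : (hullStep G X)^[2 * n] ∅ = hull G X := by
  apply Set.Subset.antisymm
  · exact iterate_induction (P := fun C => C ⊆ hull G X) _ (fun C hC => hullStep_subset_hull hC) _
      (Set.empty_subset _) _
  · have hfix := isFixedPt_iterate_set (hullStep G X) (fun S x hx => Or.inr (Or.inl hx)) ∅
    refine hull_subset (isMConvex_of_hullStep_eq hfix) fun x hx => ?_
    rw [← hfix]
    exact Or.inl hx

end Hull

section Saturation

variable {V : Type*} {G : SimpleGraph V}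

/-- The largest set avoiding `A` and `B` for which `v` is in the intersection in the definition of
the pre-saturation. -/
def witnesses (G : SimpleGraph V) (A B : Set V) (v : V) : Set V :=
  {x | x ∉ A ∧ x ∉ B ∧ v ∈ hull G {u | u ∈ A ∨ u = x}}

/-- A forbidden X has v in the intersection iff X is contained in `witnesses`. Supersets of a
forbidden set that avoid A and B are forbidden, and by finiteness each forbidden set contains a
minimal one. So one test replaces the search over the whole family. -/
theorem mem_iUnion_minForbidden_iff [Finite V] {A B : Set V} {v : V} :
    v ∈ (⋃ X ∈ minForbidden G A B, ⋂ x ∈ X, hull G (A ∪ {x})) ↔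
      (∃ a, a ∈ hull G (witnesses G A B v) ∧ a ∈ A) ∧
        ∃ b, b ∈ hull G (witnesses G A B v) ∧ b ∈ B := by
  simp only [Set.mem_iUnion, Set.mem_iInter, exists_prop]
  constructor
  · rintro ⟨X, ⟨⟨hsub, ⟨a, haX, haA⟩, ⟨b, hbX, hbB⟩⟩, -⟩, hv⟩
    have hX : X ⊆ witnesses G A B v := fun x hx =>
      ⟨fun h => hsub hx (Or.inl h), fun h => hsub hx (Or.inr h), hv x hx⟩
    exact ⟨⟨a, hull_mono hX haX, haA⟩, ⟨b, hull_mono hX hbX, hbB⟩⟩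
  · rintro ⟨⟨a, haX, haA⟩, ⟨b, hbX, hbB⟩⟩
    have hforb : IsForbidden G A B (witnesses G A B v) :=
      ⟨fun x hx h => h.elim hx.1 hx.2.1, ⟨a, haX, haA⟩, ⟨b, hbX, hbB⟩⟩
    obtain ⟨X, hX, hmin⟩ := (Set.toFinite {X | IsForbidden G A B X}).exists_le_minimal hforb
    exact ⟨X, hmin, fun x hx => (hX hx).2.2⟩

theorem preSat_eq [Finite V] (G : SimpleGraph V) (A B : Set V) :
    preSat G A B = hull G {v | (∃ a, a ∈ hull G {u | u ∈ B ∨ u = v} ∧ a ∈ A) ∨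
      (∃ a, a ∈ hull G (witnesses G A B v) ∧ a ∈ A) ∧
        ∃ b, b ∈ hull G (witnesses G A B v) ∧ b ∈ B} := by
  unfold preSat
  congr 1
  ext v
  rw [Set.mem_union, mem_iUnion_minForbidden_iff]
  rfl

theorem subset_preSat (A B : Set V) : A ⊆ preSat G A B := fun v hv =>
  subset_hull _ (Or.inl ⟨v, subset_hull _ (Or.inr rfl), hv⟩)

/-- One step of the sequence that defines the saturation, applied to the union with the initial
pair. -/
def satStep (G : SimpleGraph V) (A B : Set V) (S : Set V × Set V) : Set V × Set V :=
  (preSat G (A ∪ S.1) (B ∪ S.2), preSat G (B ∪ S.2) (A ∪ S.1))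

theorem le_satStep (A B : Set V) (S : Set V × Set V) : S ≤ satStep G A B S :=
  ⟨Set.subset_union_right.trans (subset_preSat _ _),
    Set.subset_union_right.trans (subset_preSat _ _)⟩

theorem satSeq_le_succ (A B : Set V) (i : ℕ) : satSeq G A B i ≤ satSeq G A B (i + 1) :=
  ⟨subset_preSat _ _, subset_preSat _ _⟩

theorem satSeq_monotone (A B : Set V) : Monotone (satSeq G A B) :=
  monotone_nat_of_le_succ (satSeq_le_succ A B)

/-- Started at (∅, ∅), the first step yields the pre-saturations of A and B. Afterwards the sequence
contains A and B, and the unions change nothing. -/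
theorem satStep_iterate_succ (A B : Set V) (i : ℕ) :
    (satStep G A B)^[i + 1] (∅, ∅) = satSeq G A B (i + 1) := by
  induction i with
  | zero => simp [satStep, satSeq]
  | succ i ih =>
    rw [Function.iterate_succ_apply', ih]
    have h := satSeq_monotone (G := G) A B (Nat.zero_le (i + 1))
    simp only [satStep, satSeq, Prod.mk.injEq]
    have h1 : A ∪ (satSeq G A B (i + 1)).1 = (satSeq G A B (i + 1)).1 :=
      Set.union_eq_self_of_subset_left h.1
    have h2 : B ∪ (satSeq G A B (i + 1)).2 = (satSeq G A B (i + 1)).2 :=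
      Set.union_eq_self_of_subset_left h.2
    simp only [satSeq] at h1 h2
    rw [h1, h2]
    exact ⟨rfl, rfl⟩

/-- The sequence increases and is constant from round 2n on, so the infinite union is one iterate.
-/
theorem saturation_eq {n : ℕ} (G : SimpleGraph (Fin n)) (A B : Set (Fin n)) :
    saturation G A B = ((satStep G A B)^[2 * n] (∅, ∅)).1 := by
  have hfix := isFixedPt_iterate_set_prod (satStep G A B) (le_satStep A B) (∅, ∅)
  have hsat : saturation G A B = ⋃ i : ℕ, ((satStep G A B)^[i + 1] (∅, ∅)).1 := by
    simp only [satStep_iterate_succ]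
    rfl
  rw [hsat]
  apply Set.Subset.antisymm
  · refine Set.iUnion_subset fun i => ?_
    have hmono : (satStep G A B)^[i + 1] (∅, ∅) ≤ (satStep G A B)^[i + 1 + 2 * n] (∅, ∅) :=
      Function.monotone_iterate_of_id_le (le_satStep A B) (Nat.le_add_right _ _) (∅, ∅)
    rw [Function.iterate_add_apply (n := 2 * n), Function.iterate_fixed hfix] at hmono
    exact hmono.1
  · refine Set.Subset.trans ?_ (Set.subset_iUnion _ (2 * n))
    rw [Function.iterate_succ_apply', hfix]

end Saturation

end Monophonic

/-! ### Structured programs and the stack machines that run them. -/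

namespace Monophonic

/-- The symbols on the work stacks. -/
abbrev Sym : Type := Option Bool

/-- The contents of the finite control: the last symbol that was popped. -/
abbrev Acc : Type := Option Sym

/-- Structured programs over the work stacks indexed by `K` and a write-only output stack. -/
inductive Prog (K : Type) : Type
  | skip : Prog K
  | push : K → (Acc → Sym) → Prog K
  | pop : K → Prog K
  | out : (Acc → Bool) → Prog K
  | seq : Prog K → Prog K → Prog K
  | ite : (Acc → Bool) → Prog K → Prog K → Prog K
  /-- Pop the stack and, as long as the popped symbol satisfies the condition, run the body. -/
  | loop : K → (Acc → Bool) → Prog K → Prog K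

/-- The contents of the finite control, of the work stacks and of the output stack. -/
structure Store (K : Type) where
  acc : Acc
  stk : K → List Sym
  out : List Bool

namespace Prog

variable {K : Type}

/-- The labels of the machine that runs a program. -/
def Label : Prog K → Type
  | skip => Unit
  | push _ _ => Unit
  | pop _ => Unit
  | out _ => Unit
  | seq p q => Label p ⊕ Label q
  | ite _ p q => Unit ⊕ (Label p ⊕ Label q)
  | loop _ _ p => Unit ⊕ Label p

instance instFintypeLabel : (p : Prog K) → Fintype (Label p)
  | skip => inferInstanceAs (Fintype Unit)
  | push _ _ => inferInstanceAs (Fintype Unit)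
  | pop _ => inferInstanceAs (Fintype Unit)
  | out _ => inferInstanceAs (Fintype Unit)
  | seq p q =>
    haveI := instFintypeLabel p
    haveI := instFintypeLabel q
    inferInstanceAs (Fintype (Label p ⊕ Label q))
  | ite _ p q =>
    haveI := instFintypeLabel p
    haveI := instFintypeLabel q
    inferInstanceAs (Fintype (Unit ⊕ (Label p ⊕ Label q)))
  | loop _ _ p =>
    haveI := instFintypeLabel p
    inferInstanceAs (Fintype (Unit ⊕ Label p))

/-- The label at which a program starts. -/
def start : (p : Prog K) → Label p
  | skip => ()
  | push _ _ => ()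
  | pop _ => ()
  | out _ => ()
  | seq p _ => Sum.inl (start p)
  | ite _ _ _ => Sum.inl ()
  | loop _ _ _ => Sum.inl ()

/-- The alphabets of the stacks; the output stack is `none`. -/
abbrev Alphabet : Option K → Type
  | none => Bool
  | some _ => Sym

open Turing.TM2.Stmt in
/-- The statements of the machine that runs a program and continues at the label `exit`. -/
def code {Λ : Type} : (p : Prog K) → (Label p → Λ) → Λ → Label p →
    Turing.TM2.Stmt (Alphabet (K := K)) Λ Acc
  | skip, _, exit, _ => goto fun _ => exit
  | push k f, _, exit, _ => Turing.TM2.Stmt.push (some k) f (goto fun _ => exit)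
  | pop k, _, exit, _ => Turing.TM2.Stmt.pop (some k) (fun _ x => x) (goto fun _ => exit)
  | out f, _, exit, _ => Turing.TM2.Stmt.push none f (goto fun _ => exit)
  | seq p q, emb, _, Sum.inl l => code p (emb ∘ Sum.inl) (emb (Sum.inr (start q))) l
  | seq _ q, emb, exit, Sum.inr l => code q (emb ∘ Sum.inr) exit l
  | ite c p q, emb, _, Sum.inl _ =>
    branch c (goto fun _ => emb (Sum.inr (Sum.inl (start p))))
      (goto fun _ => emb (Sum.inr (Sum.inr (start q))))
  | ite _ p _, emb, exit, Sum.inr (Sum.inl l) => code p (emb ∘ Sum.inr ∘ Sum.inl) exit l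
  | ite _ _ q, emb, exit, Sum.inr (Sum.inr l) => code q (emb ∘ Sum.inr ∘ Sum.inr) exit l
  | loop k c p, emb, exit, Sum.inl _ =>
    Turing.TM2.Stmt.pop (some k) (fun _ x => x)
      (branch c (goto fun _ => emb (Sum.inr (start p))) (goto fun _ => exit))
  | loop _ _ p, emb, _, Sum.inr l => code p (emb ∘ Sum.inr) (emb (Sum.inl ())) l

/-- The stacks of the machine that runs a program. -/
def stackFun (s : Store K) : ∀ k : Option K, List (Alphabet k)
  | none => s.out
  | some k => s.stk k

section Steps

variable {A : Type*} (f : A → Option A)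

/-- `b` is reached from `a` in at most `t` steps. -/
def StepsLE (a b : A) (t : ℕ) : Prop :=
  ∃ m ≤ t, (flip bind f)^[m] (some a) = some b

variable {f}

theorem StepsLE.single {a b : A} (h : f a = some b) : StepsLE f a b 1 :=
  ⟨1, le_rfl, h⟩

theorem StepsLE.trans {a b c : A} {t u : ℕ} (h : StepsLE f a b t) (h' : StepsLE f b c u) :
    StepsLE f a c (t + u) := by
  obtain ⟨m, hm, h⟩ := h
  obtain ⟨l, hl, h'⟩ := h'
  refine ⟨l + m, by omega, ?_⟩
  rw [Function.iterate_add_apply, h, h']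

theorem StepsLE.mono {a b : A} {t u : ℕ} (h : StepsLE f a b t) (htu : t ≤ u) :
    StepsLE f a b u := by
  obtain ⟨m, hm, h⟩ := h
  exact ⟨m, hm.trans htu, h⟩

end Steps

variable [DecidableEq K]

/-- The program `p` turns the store `s` into `s'` within `t` steps of every machine that contains
the code of `p`. -/
def Runs (p : Prog K) (s s' : Store K) (t : ℕ) : Prop :=
  ∀ (Λ : Type) (M : Λ → Turing.TM2.Stmt (Alphabet (K := K)) Λ Acc) (emb : Label p → Λ) (exit : Λ),
    (∀ l, M (emb l) = code p emb exit l) →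
      StepsLE (Turing.TM2.step M) ⟨some (emb (start p)), s.acc, stackFun s⟩
        ⟨some exit, s'.acc, stackFun s'⟩ t

theorem update_stackFun_some (s : Store K) (k : K) (l : List Sym) :
    Function.update (stackFun s) (some k) l =
      stackFun { s with stk := Function.update s.stk k l } := by
  funext j
  by_cases h : j = some k
  · subst h
    rw [Function.update_self]
    exact (Function.update_self k l s.stk).symm
  · rw [Function.update_of_ne h]
    cases j with
    | none => rfl
    | some j => exact (Function.update_of_ne (fun e => h (congrArg some e)) l s.stk).symm

theorem update_stackFun_none (s : Store K) (l : List Bool) :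
    Function.update (stackFun s) none l = stackFun { s with out := l } := by
  funext j
  cases j with
  | none => exact Function.update_self none l (stackFun s)
  | some j => exact Function.update_of_ne (Option.some_ne_none j) l (stackFun s)

theorem Runs.mono {p : Prog K} {s s' : Store K} {t u : ℕ} (h : Runs p s s' t) (htu : t ≤ u) :
    Runs p s s' u :=
  fun Λ M emb exit hM => (h Λ M emb exit hM).mono htu

theorem runs_skip (s : Store K) : Runs skip s s 1 := by
  intro Λ M emb exit hM
  apply StepsLE.single
  simp only [Turing.TM2.step, hM, code, Turing.TM2.stepAux]

theorem runs_push (s : Store K) (k : K) (f : Acc → Sym) :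
    Runs (push k f) s { s with stk := Function.update s.stk k (f s.acc :: s.stk k) } 1 := by
  intro Λ M emb exit hM
  apply StepsLE.single
  simp only [Turing.TM2.step, hM, code, Turing.TM2.stepAux]
  exact congrArg (fun S => some (Turing.TM2.Cfg.mk (some exit) s.acc S))
    (update_stackFun_some s k _)

theorem runs_pop (s : Store K) (k : K) :
    Runs (pop k) s { s with
      acc := (s.stk k).head?, stk := Function.update s.stk k (s.stk k).tail } 1 := by
  intro Λ M emb exit hM
  apply StepsLE.single
  simp only [Turing.TM2.step, hM, code, Turing.TM2.stepAux]
  exact congrArg (fun S => some (Turing.TM2.Cfg.mk (some exit) (s.stk k).head? S))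
    (update_stackFun_some s k _)

theorem runs_out (s : Store K) (f : Acc → Bool) :
    Runs (out f) s { s with out := f s.acc :: s.out } 1 := by
  intro Λ M emb exit hM
  apply StepsLE.single
  simp only [Turing.TM2.step, hM, code, Turing.TM2.stepAux]
  exact congrArg (fun S => some (Turing.TM2.Cfg.mk (some exit) s.acc S))
    (update_stackFun_none s _)

/-- `Runs` speaks of every machine that contains the code, so both parts can be run inside the same
machine, the first with the start of the second as its exit. -/
theorem Runs.seq {p q : Prog K} {s s' s'' : Store K} {t u : ℕ} (hp : Runs p s s' t)
    (hq : Runs q s' s'' u) : Runs (p.seq q) s s'' (t + u) := by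
  intro Λ M emb exit hM
  exact (hp Λ M (emb ∘ Sum.inl) (emb (Sum.inr (start q))) fun l => hM (Sum.inl l)).trans
    (hq Λ M (emb ∘ Sum.inr) exit fun l => hM (Sum.inr l))

theorem Runs.ite_true {c : Acc → Bool} {p q : Prog K} {s s' : Store K} {t : ℕ}
    (hc : c s.acc = true) (hp : Runs p s s' t) : Runs (ite c p q) s s' (t + 1) := by
  intro Λ M emb exit hM
  rw [add_comm]
  refine StepsLE.trans (StepsLE.single ?_)
    (hp Λ M (emb ∘ Sum.inr ∘ Sum.inl) exit fun l => hM (Sum.inr (Sum.inl l)))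
  have h0 := hM (Sum.inl ())
  simp only [Turing.TM2.step, start, h0, code, Turing.TM2.stepAux, hc, cond_true,
    Function.comp_apply]
  rfl

theorem Runs.ite_false {c : Acc → Bool} {p q : Prog K} {s s' : Store K} {t : ℕ}
    (hc : c s.acc = false) (hq : Runs q s s' t) : Runs (ite c p q) s s' (t + 1) := by
  intro Λ M emb exit hM
  rw [add_comm]
  refine StepsLE.trans (StepsLE.single ?_)
    (hq Λ M (emb ∘ Sum.inr ∘ Sum.inr) exit fun l => hM (Sum.inr (Sum.inr l)))
  have h0 := hM (Sum.inl ())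
  simp only [Turing.TM2.step, start, h0, code, Turing.TM2.stepAux, hc, cond_false,
    Function.comp_apply]
  rfl

theorem runs_loop_exit {k : K} {c : Acc → Bool} {p : Prog K} {s : Store K}
    (hc : c (s.stk k).head? = false) :
    Runs (loop k c p) s { s with
      acc := (s.stk k).head?, stk := Function.update s.stk k (s.stk k).tail } 1 := by
  intro Λ M emb exit hM
  apply StepsLE.single
  have hc' : c (stackFun s (some k)).head? = false := hc
  have h0 := hM (Sum.inl ())
  simp only [Turing.TM2.step, start, h0, code, Turing.TM2.stepAux, hc', cond_false]
  exact congrArg (fun S => some (Turing.TM2.Cfg.mk (some exit) (s.stk k).head? S))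
    (update_stackFun_some s k _)

theorem Runs.loop_step {k : K} {c : Acc → Bool} {p : Prog K} {s s' s'' : Store K} {t u : ℕ}
    (hc : c (s.stk k).head? = true)
    (hp : Runs p { s with
      acc := (s.stk k).head?, stk := Function.update s.stk k (s.stk k).tail } s' t)
    (hl : Runs (loop k c p) s' s'' u) : Runs (loop k c p) s s'' (1 + t + u) := by
  intro Λ M emb exit hM
  refine StepsLE.trans (StepsLE.trans (StepsLE.single ?_)
    (hp Λ M (emb ∘ Sum.inr) (emb (Sum.inl ())) fun l => hM (Sum.inr l))) (hl Λ M emb exit hM)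
  have hc' : c (stackFun s (some k)).head? = true := hc
  have h0 := hM (Sum.inl ())
  simp only [Turing.TM2.step, start, h0, code, Turing.TM2.stepAux, hc', cond_true]
  exact congrArg (fun S => some (Turing.TM2.Cfg.mk (some (emb (Sum.inr (start p))))
    (s.stk k).head? S)) (update_stackFun_some s k _)

/-- The Turing machine that runs a program, clears its finite control and halts. -/
abbrev machine [Fintype K] (p : Prog K) (k : K) : Turing.FinTM2 where
  K := Option K
  k₀ := some k
  k₁ := none
  Γ := Alphabet
  Λ := Option (Label p)
  main := some (start p)
  σ := Acc
  initialState := none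
  m
    | none => Turing.TM2.Stmt.load (fun _ => none) Turing.TM2.Stmt.halt
    | some l => code p some none l

/-- A function is computable in polynomial time if a program computes it. -/
theorem polyTimeComputable_of_runs [Fintype K] (f : Input → Output) (p : Prog K) (k : K)
    (T : Polynomial ℕ)
    (h : ∀ I : Input, ∃ v, Runs p ⟨none, Function.update (fun _ => []) k (encodeInput I), []⟩
      ⟨v, fun _ => [], encodeOutput (f I)⟩ (T.eval (encodeInput I).length)) :
    PolyTimeComputable f := by
  have key : ∀ I, ∃ m ≤ (T + 1).eval (encodeInput I).length,
      (flip bind (machine p k).step)^[m] (some (Turing.initList (machine p k) ((encodeInput I).map id))) =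
        some (Turing.haltList (machine p k) ((encodeOutput (f I)).map id)) := by
    intro I
    rw [List.map_id, List.map_id]
    obtain ⟨v, hv⟩ := h I
    have h1 := hv _ (machine p k).m some none fun _ => rfl
    -- This last step accounts for the summand 1 in T + 1: it halts and resets the finite control,
    -- as `haltList` demands.
    have h2 : StepsLE (Turing.TM2.step (machine p k).m)
        ⟨some none, v, stackFun ⟨v, fun _ => [], encodeOutput (f I)⟩⟩
        ⟨none, none, stackFun ⟨v, fun _ => [], encodeOutput (f I)⟩⟩ 1 :=
      StepsLE.single rfl
    obtain ⟨m, hm, h3⟩ := h1.trans h2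
    refine ⟨m, by simpa using hm, ?_⟩
    have hinit : Turing.initList (machine p k) (encodeInput I) =
        ⟨some (some (start p)), none,
          stackFun ⟨none, Function.update (fun _ => []) k (encodeInput I), []⟩⟩ := by
      unfold Turing.initList
      congr 1
      funext j
      cases j with
      | none => rfl
      | some j =>
        by_cases hj : j = k
        · subst hj
          simp [stackFun, machine]
        · simp [stackFun, machine, hj]
    have hhalt : Turing.haltList (machine p k) (encodeOutput (f I)) =
        ⟨none, none, stackFun ⟨v, fun _ => [], encodeOutput (f I)⟩⟩ := by
      unfold Turing.haltList
      congr 1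
      funext j
      cases j with
      | none => rfl
      | some j => rfl
    rw [hinit, hhalt]
    exact h3
  choose m hm hm' using key
  exact ⟨{
    tm := machine p k
    inputAlphabet := Equiv.refl _
    outputAlphabet := Equiv.refl _
    time := T + 1
    outputsFun := fun I =>
      { steps := m I
        evals_in_steps := hm' I
        steps_le_m := hm I } }⟩

end Prog

end Monophonic

/-! ### Subroutines: unary counters, copying and lookup. -/

namespace Monophonic

namespace Prog

section Macros

variable {K : Type} [DecidableEq K]

/-- The program `p` turns the work stacks `S` into `S'` within `t` steps, whatever the contents of
the finite control, and leaves the output stack alone. -/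
def Does (p : Prog K) (S S' : K → List Sym) (t : ℕ) : Prop :=
  ∀ v o, ∃ v', Runs p ⟨v, S, o⟩ ⟨v', S', o⟩ t

theorem Does.mono {p : Prog K} {S S' : K → List Sym} {t u : ℕ} (h : Does p S S' t)
    (htu : t ≤ u) : Does p S S' u := by
  intro v o
  obtain ⟨v', h⟩ := h v o
  exact ⟨v', h.mono htu⟩

theorem Does.seq {p q : Prog K} {S S' S'' : K → List Sym} {t u : ℕ} (hp : Does p S S' t)
    (hq : Does q S' S'' u) : Does (p.seq q) S S'' (t + u) := by
  intro v o
  obtain ⟨v', h⟩ := hp v o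
  obtain ⟨v'', h'⟩ := hq v' o
  exact ⟨v'', h.seq h'⟩

theorem Does.of_eq {p : Prog K} {S S' T T' : K → List Sym} {t : ℕ} (h : Does p S S' t)
    (hS : S = T) (hS' : S' = T') : Does p T T' t := by
  subst hS hS'
  exact h

theorem Runs.cast {p : Prog K} {v v' : Acc} {S S' S'' : K → List Sym} {o o' : List Bool} {t u : ℕ}
    (h : Runs p ⟨v, S, o⟩ ⟨v', S', o'⟩ t) (hS : S' = S'') (htu : t ≤ u) :
    Runs p ⟨v, S, o⟩ ⟨v', S'', o'⟩ u := by
  subst hS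
  exact h.mono htu

theorem does_skip (S : K → List Sym) : Does skip S S 1 :=
  fun v _ => ⟨v, runs_skip _⟩

/-- Push a symbol that does not depend on the finite control. -/
def put (k : K) (a : Sym) : Prog K := push k fun _ => a

theorem does_put (S : K → List Sym) (k : K) (a : Sym) :
    Does (put k a) S (Function.update S k (a :: S k)) 1 :=
  fun v o => ⟨v, runs_push ⟨v, S, o⟩ k _⟩

theorem does_pop (S : K → List Sym) (k : K) :
    Does (pop k) S (Function.update S k (S k).tail) 1 :=
  fun v o => ⟨_, runs_pop ⟨v, S, o⟩ k⟩

/-- Push the symbol that was popped last, if there was one. -/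
def unpop (k : K) : Prog K :=
  ite Option.isSome (push k fun v => v.getD none) skip

theorem runs_unpop (v : Acc) (S : K → List Sym) (o : List Bool) (k : K) :
    Runs (unpop k) ⟨v, S, o⟩ ⟨v, Function.update S k (v.toList ++ S k), o⟩ 2 := by
  cases v with
  | none =>
    refine Runs.ite_false rfl ?_
    have := runs_skip (⟨none, S, o⟩ : Store K)
    simpa using this
  | some a => exact Runs.ite_true rfl (runs_push _ _ _)

/-- Move one symbol, if there is one, from the stack `a` to the stack `b`. -/
def shift (a b : K) : Prog K := seq (pop a) (unpop b)

theorem does_shift (S : K → List Sym) {a b : K} (hab : a ≠ b) :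
    Does (shift a b) S
      (Function.update (Function.update S a (S a).tail) b ((S a).head?.toList ++ S b)) 3 := by
  intro v o
  refine ⟨_, (runs_pop ⟨v, S, o⟩ a).seq (?_ : Runs _ _ ⟨(S a).head?, _, o⟩ 2)⟩
  have := runs_unpop (S a).head? (Function.update S a (S a).tail) o b
  rwa [Function.update_of_ne hab.symm] at this

/-- Run the body as often as there are symbols on the stack `k`. -/
def repeatFor (k : K) (p : Prog K) : Prog K := loop k Option.isSome p

/-- f i describes the stacks when round i begins. The loop test itself pops the counter; it costs
one step per round, and one more for the failing test at the end. -/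
theorem does_repeatFor {k : K} {p : Prog K} {T : ℕ} (m : ℕ) (f : ℕ → K → List Sym)
    (hk : ∀ i ≤ m, (f i k).length = m - i)
    (hstep : ∀ i < m, Does p (Function.update (f i) k (f i k).tail) (f (i + 1)) T) :
    Does (repeatFor k p) (f 0) (f m) (m * (T + 1) + 1) := by
  induction m generalizing f with
  | zero =>
    intro v o
    have h0 : f 0 k = [] := List.length_eq_zero_iff.1 (by simpa using hk 0 le_rfl)
    have := runs_loop_exit (k := k) (c := Option.isSome) (p := p) (s := ⟨v, f 0, o⟩)
      (by simp [h0])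
    refine ⟨_, this.cast ?_ (by omega)⟩
    simp only [h0, List.tail_nil]
    rw [← h0, Function.update_eq_self]
  | succ m ih =>
    intro v o
    have h0 : (f 0 k).length = m + 1 := hk 0 (Nat.zero_le _)
    obtain ⟨v', h1⟩ := hstep 0 (by omega) (f 0 k).head? o
    obtain ⟨v'', h2⟩ := ih (fun i => f (i + 1))
      (fun i hi => by rw [hk (i + 1) (by omega)]; omega)
      (fun i hi => hstep (i + 1) (by omega)) v' o
    refine ⟨v'', (Runs.loop_step ?_ h1 h2).mono (by ring_nf; omega)⟩
    cases h : f 0 k with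
    | nil => rw [h] at h0; simp at h0
    | cons a l => simp [h]

/-- Move all symbols from the stack `a` to the stack `b`. -/
def move (a b : K) : Prog K := loop a Option.isSome (push b fun v => v.getD none)

theorem does_move (S : K → List Sym) {a b : K} (hab : a ≠ b) :
    Does (move a b) S
      (Function.update (Function.update S a []) b ((S a).reverse ++ S b))
      (2 * (S a).length + 1) := by
  obtain ⟨l, hl⟩ : ∃ l, S a = l := ⟨_, rfl⟩
  rw [hl]
  induction l generalizing S with
  | nil =>
    intro v o
    have := runs_loop_exit (k := a) (c := Option.isSome) (p := push b fun v => v.getD none)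
      (s := ⟨v, S, o⟩) (by simp [hl])
    refine ⟨_, this.cast ?_ (by simp)⟩
    simp only [hl, List.tail_nil]
    rw [List.reverse_nil, List.nil_append,
      show S b = Function.update S a [] b from (Function.update_of_ne hab.symm _ _).symm,
      Function.update_eq_self]
  | cons x l ih =>
    intro v o
    obtain ⟨v', h2⟩ := ih (Function.update (Function.update S a l) b (x :: S b))
      (by rw [Function.update_of_ne hab, Function.update_self]) (some x) o
    have h1 := runs_push (⟨some x, Function.update S a l, o⟩ : Store K) b (fun v => v.getD none)
    simp only [Option.getD_some, Function.update_of_ne hab.symm] at h1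
    have h3 := Runs.loop_step (k := a) (c := Option.isSome) (s := ⟨v, S, o⟩) (t := 1)
      (by simp [hl]) (by simpa only [hl, List.head?_cons, List.tail_cons] using h1) h2
    refine ⟨v', h3.cast ?_ (by simp; omega)⟩
    funext j
    simp only [Function.update_apply]
    split_ifs <;> simp_all

/-- Empty the stack `k`. -/
def clear (k : K) : Prog K := repeatFor k skip

theorem does_clear (S : K → List Sym) (k : K) :
    Does (clear k) S (Function.update S k []) (2 * (S k).length + 1) := by
  have h := does_repeatFor (k := k) (p := skip) (T := 1) (S k).length
    (fun i => Function.update S k ((S k).drop i)) (by simp) (by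
      intro i hi
      refine (does_skip _).of_eq rfl ?_
      simp)
  refine (h.mono (by omega)).of_eq (by simp) (by simp)

/-- Push as many symbols on the stack `b` as there are on the stack `a`, with the help of the
empty stack `t`. -/
def copy (a b t : K) : Prog K :=
  seq (repeatFor a (seq (put t none) (put b none))) (move t a)

/-- Counting destroys the counter, so it is saved on t and moved back. -/
theorem does_copy (S : K → List Sym) {a b t : K} (hab : a ≠ b) (hat : a ≠ t) (hbt : b ≠ t)
    (m : ℕ) (ha : S a = List.replicate m none) (ht : S t = []) :
    Does (copy a b t) S (Function.update S b (List.replicate m none ++ S b)) (5 * m + 2) := by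
  have h := does_repeatFor (k := a) (p := seq (put t none) (put b none)) (T := 2) m
    (fun i => Function.update (Function.update (Function.update S a (List.replicate (m - i) none))
      t (List.replicate i none)) b (List.replicate i none ++ S b))
    (by intro i hi; simp [hab, hat]) (by
      intro i hi
      refine ((does_put _ _ _).seq (does_put _ _ _)).of_eq rfl ?_
      funext j
      simp only [Function.update_apply]
      split_ifs <;> simp_all [List.replicate_succ]
      omega)
  refine ((h.seq (does_move _ hat.symm)).mono ?_).of_eq ?_ ?_
  · simp [hbt.symm]
    omega
  · funext j
    simp only [Function.update_apply]
    split_ifs <;> simp_all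
  · funext j
    simp only [Function.update_apply]
    split_ifs <;> simp_all

/-- Move as many symbols from the stack `a` to the stack `b` as there are on the stack `x`, with
the help of the empty stack `t`. -/
def seek (x a b t : K) : Prog K :=
  seq (repeatFor x (seq (put t none) (shift a b))) (move t x)

theorem does_seek (S : K → List Sym) {x a b t : K} (h : [x, a, b, t].Nodup)
    (m : ℕ) (hx : S x = List.replicate m none) (ht : S t = []) :
    Does (seek x a b t) S
      (Function.update (Function.update S a ((S a).drop m)) b (((S a).take m).reverse ++ S b))
      (7 * m + 2) := by
  simp only [List.nodup_cons, List.mem_cons, List.not_mem_nil, not_or, or_false,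
    not_false_eq_true, List.nodup_nil, and_true] at h
  obtain ⟨⟨hxa, hxb, hxt⟩, ⟨hab, hat⟩, hbt⟩ := h
  have h := does_repeatFor (k := x) (p := seq (put t none) (shift a b)) (T := 4) m
    (fun i => Function.update (Function.update (Function.update (Function.update S x
      (List.replicate (m - i) none)) t (List.replicate i none)) a ((S a).drop i)) b
        (((S a).take i).reverse ++ S b))
    (by intro i hi; simp [hxa, hxb, hxt]) (by
      intro i hi
      refine ((does_put _ _ _).seq (does_shift _ hab)).of_eq rfl ?_
      funext j
      simp only [Function.update_apply]
      split_ifs <;> simp_all [List.replicate_succ, List.take_add_one]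
      · cases (S a)[i]? <;> rfl
      · omega)
  refine ((h.seq (does_move _ (Ne.symm hxt))).mono ?_).of_eq ?_ ?_
  · simp [Ne.symm hbt, Ne.symm hat]
    omega
  · funext j
    simp only [Function.update_apply]
    split_ifs <;> simp_all
  · funext j
    simp only [Function.update_apply]
    split_ifs <;> simp_all

/-- Push `g` of the top symbol of the stack `a` on the stack `r` and move the stack `b` back to
the stack `a`. -/
def report (a b r : K) (g : Acc → Sym) : Prog K :=
  seq (pop a) (seq (push r g) (seq (unpop a) (move b a)))

/-- The stacks a and b hold the list l cut at position m, with the front part reversed. If m is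
beyond the end, g is applied to `none`. -/
theorem does_report (S : K → List Sym) {a b r : K} (hab : a ≠ b) (har : a ≠ r) (hbr : b ≠ r)
    (g : Acc → Sym) (l : List Sym) (m : ℕ) (ha : S a = l.drop m) (hb : S b = (l.take m).reverse) :
    Does (report a b r g) S
      (Function.update (Function.update (Function.update S a l) b []) r (g l[m]? :: S r))
      (2 * m + 5) := by
  intro v o
  have h1 := runs_pop (⟨v, S, o⟩ : Store K) a
  have h2 := runs_push (⟨(S a).head?, Function.update S a (S a).tail, o⟩ : Store K) r g
  have h3 := runs_unpop (S a).head? (Function.update (Function.update S a (S a).tail) r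
    (g (S a).head? :: Function.update S a (S a).tail r)) o a
  obtain ⟨v', h4⟩ := does_move (Function.update (Function.update (Function.update S a (S a).tail) r
    (g (S a).head? :: Function.update S a (S a).tail r)) a ((S a).head?.toList ++
      Function.update (Function.update S a (S a).tail) r
    (g (S a).head? :: Function.update S a (S a).tail r) a)) hab.symm (S a).head? o
  refine ⟨v', (h1.seq (h2.seq (h3.seq h4))).cast ?_ ?_⟩
  · have hhead : (l.drop m).head?.toList ++ (l.drop m).tail = l.drop m := by
      cases l.drop m <;> rfl
    funext j
    simp only [Function.update_apply]
    split_ifs <;> simp_all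
  · simp [hab.symm, hbr, hb]
    omega

/-- Look up the symbol on the stack `a` whose position is given by the stack `x`. -/
def lookup (x a b t r : K) (g : Acc → Sym) : Prog K :=
  seq (seek x a b t) (report a b r g)

theorem does_lookup (S : K → List Sym) {x a b t r : K} (h : [x, a, b, t].Nodup) (har : a ≠ r)
    (hbr : b ≠ r) (g : Acc → Sym) (m : ℕ) (hx : S x = List.replicate m none) (ht : S t = [])
    (hb : S b = []) :
    Does (lookup x a b t r g) S (Function.update S r (g (S a)[m]? :: S r)) (9 * m + 7) := by
  have hab : a ≠ b := by
    simp only [List.nodup_cons, List.mem_cons, not_or] at h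
    exact h.2.1.1
  refine (((does_seek S h m hx ht).seq
    (does_report _ hab har hbr g (S a) m ?_ ?_)).mono ?_).of_eq rfl ?_
  · simp [hab]
  · simp [hb]
  · omega
  · funext j
    simp only [Function.update_apply]
    split_ifs <;> simp_all

/-- Move as many rows from the stack `a` to the stack `b` as there are symbols on the stack `c`,
where the stack `w` gives the length of a row. -/
def seekRow (c w a b t u : K) : Prog K :=
  seq (repeatFor c (seq (put u none) (seek w a b t))) (move u c)

theorem does_seekRow (S : K → List Sym) {c w a b t u : K} (h : [c, w, a, b, t, u].Nodup)
    (m n : ℕ) (hc : S c = List.replicate m none) (hw : S w = List.replicate n none)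
    (ht : S t = []) (hu : S u = []) :
    Does (seekRow c w a b t u) S
      (Function.update (Function.update S a ((S a).drop (m * n))) b
        (((S a).take (m * n)).reverse ++ S b))
      (m * (7 * n + 6) + 2) := by
  have hn : [w, a, b, t].Nodup := by
    simp only [List.nodup_cons, List.mem_cons, not_or] at h ⊢
    tauto
  simp only [List.nodup_cons, List.mem_cons, List.not_mem_nil, not_or, or_false,
    not_false_eq_true, List.nodup_nil, and_true] at h
  obtain ⟨⟨hcw, hca, hcb, hct, hcu⟩, ⟨hwa, hwb, hwt, hwu⟩, ⟨hab, hat, hau⟩, ⟨hbt, hbu⟩, htu⟩ := h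
  have h := does_repeatFor (k := c) (p := seq (put u none) (seek w a b t)) (T := 7 * n + 3) m
    (fun i => Function.update (Function.update (Function.update (Function.update S c
      (List.replicate (m - i) none)) u (List.replicate i none)) a ((S a).drop (i * n))) b
        (((S a).take (i * n)).reverse ++ S b))
    (by intro i hi; simp [hca, hcb, hcu]) (by
      intro i hi
      refine (((does_put _ _ _).seq (does_seek _ hn n ?_ ?_)).mono (by omega)).of_eq rfl ?_
      · simp [Ne.symm hcw, hwa, hwb, hwu, hw]
      · simp [Ne.symm hct, Ne.symm hat, Ne.symm hbt, htu, ht]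
      · have e : (i + 1) * n = i * n + n := by ring
        rw [e]
        funext j
        simp only [Function.update_apply]
        split_ifs <;> simp_all [List.replicate_succ, List.take_add]
        omega)
  refine ((h.seq (does_move _ (Ne.symm hcu))).mono ?_).of_eq ?_ ?_
  · simp [Ne.symm hbu, Ne.symm hau]
    ring_nf
    omega
  · funext j
    simp only [Function.update_apply]
    split_ifs <;> simp_all
  · funext j
    simp only [Function.update_apply]
    split_ifs <;> simp_all

/-- Look up the symbol on the stack `a` in the row that is given by the stack `c` and the column
that is given by the stack `x`. -/
def lookupCell (c x w a b t u r : K) (g : Acc → Sym) : Prog K :=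
  seq (seekRow c w a b t u) (seq (seek x a b t) (report a b r g))

theorem does_lookupCell (S : K → List Sym) {c x w a b t u r : K} (h : [c, w, a, b, t, u].Nodup)
    (hx : [x, a, b, t].Nodup) (har : a ≠ r) (hbr : b ≠ r) (g : Acc → Sym) (m n k : ℕ)
    (hcS : S c = List.replicate m none) (hwS : S w = List.replicate n none)
    (hxS : S x = List.replicate k none) (ht : S t = []) (hu : S u = []) (hb : S b = []) :
    Does (lookupCell c x w a b t u r g) S (Function.update S r (g (S a)[m * n + k]? :: S r))
      (m * (9 * n + 6) + 9 * k + 9) := by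
  have hx' := hx
  simp only [List.nodup_cons, List.mem_cons, List.not_mem_nil, not_or, or_false,
    not_false_eq_true, List.nodup_nil, and_true] at hx'
  obtain ⟨⟨hxa, hxb, hxt⟩, ⟨hab, hat⟩, hbt⟩ := hx'
  refine (((does_seekRow S h m n hcS hwS ht hu).seq ((does_seek _ hx k ?_ ?_).seq
    (does_report _ hab har hbr g (S a) (m * n + k) ?_ ?_))).mono ?_).of_eq rfl ?_
  · simp [hxa, hxb, hxS]
  · simp [Ne.symm hat, Ne.symm hbt, ht]
  · simp [hab]
  · simp [hab, hb, List.take_add]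
  · ring_nf
    omega
  · funext j
    simp only [Function.update_apply]
    split_ifs <;> simp_all

end Macros

end Prog

end Monophonic

/-! ### Fixed point formulas and the stack layout of their evaluation. -/

namespace Monophonic

open Prog

/-- The counters that are computed from the input once and for all. -/
inductive Counter : Type
  | size
  | width
  | rowA
  | rowB
  | twice
  deriving DecidableEq

instance : Fintype Counter :=
  ⟨{.size, .width, .rowA, .rowB, .twice}, fun c => by cases c <;> decide⟩

/-- The values of the counters for a graph with `n` vertices. -/
def Counter.value (n : ℕ) : Counter → ℕ
  | size => n
  | width => n + 1
  | rowA => n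
  | rowB => n + 1
  | twice => 2 * n

/-- The work stacks of the machine that evaluates a formula with the vertex variables `α` and the
set variables `β`. -/
inductive Stk (α β : Type) : Type
  | inp
  | tmp
  | res
  | aux₁
  | aux₂
  | num (c : Counter)
  | var (a : α)
  | rem (a : α)
  | set (b : β) (i : Bool)
  | iter (b : β)
  deriving DecidableEq, Fintype

/-- Formulas about the vertices of a graph, with a fixed point operator that iterates a map on pairs
of sets. -/
inductive Fml (α β : Type) : Type
  | inA (x : α)
  | inB (x : α)
  | edge (x y : α)
  | le (x y : α)
  | mem (i : Bool) (b : β) (x : α)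
  | neg (φ : Fml α β)
  | and (φ ψ : Fml α β)
  | ex (x : α) (φ : Fml α β)
  | fix (b : β) (x : α) (φ ψ χ : Fml α β)

variable {α β : Type}

/-- The components of a pair of sets. -/
def side {γ : Type} (i : Bool) (S : γ × γ) : γ := cond i S.2 S.1

section Config

/-- The stack contents between two evaluations. -/
noncomputable def config (I : Input) (e ρ : α → ℕ) (L : β → Bool → List Sym) (κ : β → ℕ) (r : List Sym) :
    Stk α β → List Sym
  | .inp => encodeInput I
  | .tmp => []
  | .res => r
  | .aux₁ => []
  | .aux₂ => []
  | .num c => List.replicate (c.value I.n) none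
  | .var a => List.replicate (e a) none
  | .rem a => List.replicate (ρ a) none
  | .set b i => L b i
  | .iter b => List.replicate (κ b) none

/-- The set that a list of bits stands for. -/
def toSet (n : ℕ) (l : List Sym) : Set (Fin n) :=
  {i | l[(i : ℕ)]? = some (some true)}

theorem toSet_nil (n : ℕ) : toSet n [] = ∅ := by
  ext i
  simp [toSet]

theorem toSet_map_bits {n : ℕ} (S : Set (Fin n)) : toSet n ((bits S).map some) = S := by
  ext i
  simp [toSet, bits]

theorem length_map_bits {n : ℕ} (S : Set (Fin n)) :
    ((bits S).map (some : Bool → Sym)).length = n := by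
  simp [bits]

/-- The values of the set variables. -/
def setEnv (n : ℕ) (L : β → Bool → List Sym) (b : β) : Set (Fin n) × Set (Fin n) :=
  (toSet n (L b false), toSet n (L b true))

variable [DecidableEq α] [DecidableEq β]

theorem setEnv_update (n : ℕ) (L : β → Bool → List Sym) (b : β) (l : Bool → List Sym) :
    setEnv n (Function.update L b l) =
      Function.update (setEnv n L) b (toSet n (l false), toSet n (l true)) := by
  funext c
  by_cases h : c = b
  · subst h
    simp [setEnv]
  · simp [setEnv, h]

theorem val_update {n : ℕ} (env : α → Fin n) (x : α) (i : Fin n) :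
    (fun a => ((Function.update env x i a : Fin n) : ℕ)) =
      Function.update (fun a => (env a : ℕ)) x (i : ℕ) := by
  funext a
  by_cases h : a = x
  · subst h
    simp
  · simp [h]

variable (I : Input) (e ρ : α → ℕ) (L : β → Bool → List Sym) (κ : β → ℕ) (r : List Sym)

theorem update_config_res (r' : List Sym) :
    Function.update (config I e ρ L κ r) .res r' = config I e ρ L κ r' := by
  funext j
  cases j <;> simp [config]

theorem update_config_var (x : α) (m : ℕ) (l : List Sym) (hl : l = List.replicate m none) :
    Function.update (config I e ρ L κ r) (.var x) l =
      config I (Function.update e x m) ρ L κ r := by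
  subst hl
  funext j
  cases j <;> simp [config, Function.update_apply]
  split_ifs <;> rfl

theorem update_config_rem (x : α) (m : ℕ) (l : List Sym) (hl : l = List.replicate m none) :
    Function.update (config I e ρ L κ r) (.rem x) l =
      config I e (Function.update ρ x m) L κ r := by
  subst hl
  funext j
  cases j <;> simp [config, Function.update_apply]
  split_ifs <;> rfl

theorem update_config_iter (b : β) (m : ℕ) (l : List Sym) (hl : l = List.replicate m none) :
    Function.update (config I e ρ L κ r) (.iter b) l =
      config I e ρ L (Function.update κ b m) r := by
  subst hl
  funext j
  cases j <;> simp [config, Function.update_apply]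
  split_ifs <;> rfl

theorem update_config_set (b : β) (i : Bool) (l : List Sym) :
    Function.update (config I e ρ L κ r) (.set b i) l =
      config I e ρ (Function.update L b (Function.update (L b) i l)) κ r := by
  funext j
  cases j <;> simp [config, Function.update_apply]
  split_ifs <;> simp_all

end Config

section ForVertex

variable [DecidableEq α] [DecidableEq β]

/-- Run the body for all values of the vertex variable `x`. -/
def forVertex (x : α) (p : Prog (Stk α β)) : Prog (Stk α β) :=
  seq (copy (.num .size) (.rem x) .aux₁)
    (seq (repeatFor (.rem x) (seq p (put (.var x) none))) (clear (.var x)))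

/-- The value of x counts up in unary on `var x`, and the rounds that remain count down on `rem x`.
In round i the remainder is n - 1 - i because the loop test has already popped one symbol. Both
stacks are empty again at the end. -/
theorem does_forVertex {I : Input} {e ρ : α → ℕ} {L : β → Bool → List Sym} {κ : β → ℕ} {x : α}
    {p : Prog (Stk α β)} {T : ℕ} (r : ℕ → List Sym) (he : e x = 0) (hρ : ρ x = 0)
    (hp : ∀ i < I.n, Does p
      (config I (Function.update e x i) (Function.update ρ x (I.n - 1 - i)) L κ (r i))
      (config I (Function.update e x i) (Function.update ρ x (I.n - 1 - i)) L κ (r (i + 1))) T) :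
    Does (forVertex x p) (config I e ρ L κ (r 0)) (config I e ρ L κ (r I.n))
      (I.n * (T + 2) + 7 * I.n + 4) := by
  have h1 : Does (copy (.num .size) (.rem x) .aux₁) (config I e ρ L κ (r 0))
      (config I e (Function.update ρ x I.n) L κ (r 0)) (5 * I.n + 2) :=
    (does_copy (config I e ρ L κ (r 0)) (by simp) (by simp) (by simp) I.n rfl rfl).of_eq rfl
      (update_config_rem _ _ _ _ _ _ _ _ _ (by simp [config, hρ]))
  have h2 := does_repeatFor (k := .rem x) (p := seq p (put (.var x) none)) (T := T + 1) I.n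
    (fun i => config I (Function.update e x i) (Function.update ρ x (I.n - i)) L κ (r i))
    (by simp [config]) (by
      intro i hi
      refine ((hp i hi).seq (does_put _ _ _)).of_eq ?_ ?_
      · rw [update_config_rem (m := I.n - 1 - i)]
        · simp
        · simp only [config, Function.update_self, List.tail_replicate]
          congr 1
          omega
      · rw [update_config_var (m := i + 1)]
        · simp only [Function.update_idem]
          congr 2
          omega
        · simp [config, List.replicate_succ])
  have h3 := does_clear (config I (Function.update e x I.n) (Function.update ρ x 0) L κ (r I.n))
    (.var x)
  have hρ' : Function.update ρ x 0 = ρ := by rw [← hρ, Function.update_eq_self]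
  have he' : Function.update e x 0 = e := by rw [← he, Function.update_eq_self]
  refine ((h1.seq ((h2.of_eq ?_ rfl).seq (h3.of_eq ?_ ?_))).mono ?_)
  · simp [he']
  · simp
  · rw [update_config_var (m := 0) (l := []) (hl := rfl)]
    simp [he', hρ']
  · simp [config]
    ring_nf
    omega

end ForVertex

namespace Fml

/-- The truth value of a formula. -/
def eval (I : Input) [DecidableEq α] [DecidableEq β] :
    Fml α β → (α → Fin I.n) → (β → Set (Fin I.n) × Set (Fin I.n)) → Prop
  | inA x, e, _ => e x ∈ I.A
  | inB x, e, _ => e x ∈ I.B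
  | edge x y, e, _ => I.graph.Adj (e x) (e y)
  | le x y, e, _ => e x ≤ e y
  | mem i b x, e, s => e x ∈ side i (s b)
  | neg φ, e, s => ¬ eval I φ e s
  | and φ ψ, e, s => eval I φ e s ∧ eval I ψ e s
  | ex x φ, e, s => ∃ i, eval I φ (Function.update e x i) s
  | fix b x φ ψ χ, e, s => eval I χ e (Function.update s b
      ((fun S : Set (Fin I.n) × Set (Fin I.n) =>
        ({i | eval I φ (Function.update e x i) (Function.update s b S)},
          {i | eval I ψ (Function.update e x i) (Function.update s b S)}))^[2 * I.n] (∅, ∅)))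

variable [DecidableEq α] [DecidableEq β]

/-- Whether a formula binds a vertex variable. -/
def bindsVar : Fml α β → α → Bool
  | neg φ, y => bindsVar φ y
  | and φ ψ, y => bindsVar φ y || bindsVar ψ y
  | ex x φ, y => y == x || bindsVar φ y
  | fix _ x φ ψ χ, y => y == x || bindsVar φ y || bindsVar ψ y || bindsVar χ y
  | _, _ => false

/-- Whether a formula binds a set variable. -/
def bindsSet : Fml α β → β → Bool
  | neg φ, c => bindsSet φ c
  | and φ ψ, c => bindsSet φ c || bindsSet ψ c
  | ex _ φ, c => bindsSet φ c
  | fix b _ φ ψ χ, c => c == b || bindsSet φ c || bindsSet ψ c || bindsSet χ c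
  | _, _ => false

/-- No variable is bound again within the scope of a quantifier or fixed point operator that binds
it. -/
def wellFormed : Fml α β → Bool
  | neg φ => wellFormed φ
  | and φ ψ => wellFormed φ && wellFormed ψ
  | ex x φ => !bindsVar φ x && wellFormed φ
  | fix b x φ ψ χ => !bindsVar φ x && !bindsVar ψ x && !bindsSet φ b && !bindsSet ψ b &&
      !bindsSet χ b && wellFormed φ && wellFormed ψ && wellFormed χ
  | _ => true

/-- The stacks of the bound variables are empty. -/
def Fresh (φ : Fml α β) (e ρ : α → ℕ) (L : β → Bool → List Sym) (κ : β → ℕ) : Prop :=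
  (∀ x, bindsVar φ x = true → e x = 0 ∧ ρ x = 0) ∧
    ∀ b, bindsSet φ b = true → (∀ i, L b i = []) ∧ κ b = 0

open Classical in
/-- The symbol for the truth value of a proposition. -/
noncomputable def bit (P : Prop) : Sym := some (decide P)

/-- The program `p` pushes the truth value of `φ` on the stack for results. -/
def ComputedBy (φ : Fml α β) (p : Prog (Stk α β)) (T : Polynomial ℕ) : Prop :=
  ∀ (I : Input) (e : α → Fin I.n) (ρ : α → ℕ) (L : β → Bool → List Sym) (κ : β → ℕ) (r : List Sym),
    φ.Fresh (fun a => e a) ρ L κ →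
      Does p (config I (fun a => e a) ρ L κ r)
        (config I (fun a => e a) ρ L κ (bit (φ.eval I e (setEnv I.n L)) :: r)) (T.eval I.n)

end Fml

end Monophonic

/-! ### Evaluating atoms and connectives. -/

namespace Monophonic

open Prog

variable {α β : Type}

section Cells

theorem getElem?_flatten_of_length {γ : Type} (w : ℕ) (M : List (List γ))
    (hM : ∀ l ∈ M, l.length = w) (i j : ℕ) (hj : j < w) (hi : i < M.length) :
    M.flatten[i * w + j]? = M[i][j]? := by
  induction M generalizing i with
  | nil => simp at hi
  | cons l M ih =>
    have hl : l.length = w := hM l (by simp)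
    cases i with
    | zero =>
      rw [List.flatten_cons, List.getElem?_append_left (by omega)]
      simp
    | succ i =>
      have e : (i + 1) * w + j = l.length + (i * w + j) := by rw [hl]; ring
      rw [List.flatten_cons, e, List.getElem?_append_right (by omega), Nat.add_sub_cancel_left,
        ih (fun l hl => hM l (by simp [hl])) i (by simpa using hi)]
      simp

theorem length_row {n : ℕ} (S : Set (Fin n)) : (row S).length = n + 1 := by
  simp [row, bits]

open Classical in
theorem getElem?_row {n : ℕ} (S : Set (Fin n)) (j : Fin n) :
    (row S)[(j : ℕ)]? = some (some (decide (j ∈ S))) := by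
  rw [row, List.getElem?_append_left (by simp [bits])]
  simp [bits]

theorem encodeInput_eq_flatten (I : Input) : encodeInput I =
    ((List.ofFn fun i => row (I.graph.neighborSet i)) ++ [row I.A, row I.B]).flatten := by
  simp [encodeInput]

theorem getElem?_encodeInput (I : Input) (i : ℕ) (hi : i < I.n + 2) (S : Set (Fin I.n))
    (hS : ((List.ofFn fun i => row (I.graph.neighborSet i)) ++ [row I.A, row I.B])[i]'(by
      simpa using hi) = row S) (j : Fin I.n) :
    (encodeInput I)[i * (I.n + 1) + j]? = some (Fml.bit (j ∈ S)) := by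
  rw [encodeInput_eq_flatten, getElem?_flatten_of_length (I.n + 1) _ _ i j (by omega)
    (by simpa using hi), hS, getElem?_row]
  · rfl
  · intro l hl
    simp only [List.mem_append, List.mem_ofFn, List.mem_cons, List.not_mem_nil, or_false] at hl
    rcases hl with ⟨i, rfl⟩ | rfl | rfl <;> exact length_row _

theorem getElem?_encodeInput_graph (I : Input) (i j : Fin I.n) :
    (encodeInput I)[(i : ℕ) * (I.n + 1) + j]? = some (Fml.bit (I.graph.Adj i j)) :=
  getElem?_encodeInput I i (by omega) (I.graph.neighborSet i) (by simp) j

theorem getElem?_encodeInput_A (I : Input) (j : Fin I.n) :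
    (encodeInput I)[I.n * (I.n + 1) + j]? = some (Fml.bit (j ∈ I.A)) :=
  getElem?_encodeInput I I.n (by omega) I.A (by simp) j

theorem getElem?_encodeInput_B (I : Input) (j : Fin I.n) :
    (encodeInput I)[(I.n + 1) * (I.n + 1) + j]? = some (Fml.bit (j ∈ I.B)) :=
  getElem?_encodeInput I (I.n + 1) (by omega) I.B (by simp [List.getElem_append_right]) j

end Cells

namespace Fml

variable [DecidableEq α] [DecidableEq β]

section Atoms

/-- Look up a symbol of the input. -/
def readCell (c : Stk α β) (x : α) : Prog (Stk α β) :=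
  lookupCell c (.var x) (.num .width) .inp .tmp .aux₁ .aux₂ .res fun v => v.getD none

theorem does_readCell {c : Stk α β} (hc : [c, .num .width, .inp, .tmp, .aux₁, .aux₂].Nodup)
    (x : α) (I : Input) (e ρ : α → ℕ) (L : β → Bool → List Sym) (κ : β → ℕ) (r : List Sym) (m : ℕ)
    (hcm : config I e ρ L κ r c = List.replicate m none) (a : Sym)
    (ha : (encodeInput I)[m * (I.n + 1) + e x]? = some a) (hm : m ≤ I.n + 1) (hx : e x ≤ I.n) :
    Does (readCell c x) (config I e ρ L κ r) (config I e ρ L κ (a :: r))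
      ((I.n + 1) * (9 * (I.n + 1) + 6) + 9 * I.n + 9) := by
  have h := does_lookupCell (config I e ρ L κ r) hc (x := .var x) (r := .res) (by simp) (by simp)
    (by simp) (fun v => v.getD none) m (I.n + 1) (e x) hcm rfl rfl rfl rfl rfl
  refine (h.mono ?_).of_eq rfl ?_
  · gcongr
  · rw [update_config_res]
    simp only [config]
    rw [ha]
    rfl

open Polynomial in
theorem computedBy_edge (x y : α) :
    ComputedBy (edge x y : Fml α β) (readCell (.var x) y)
      ((X + 1) * (9 * (X + 1) + 6) + 9 * X + 9) := by
  intro I e ρ L κ r _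
  refine (does_readCell (by simp) y I _ ρ L κ r (e x) rfl _
    (getElem?_encodeInput_graph I (e x) (e y)) (by omega) (by simp)).mono ?_
  simp

-- The characteristic vectors of A and B follow the adjacency matrix as rows n and n + 1, which are
-- the values of `rowA` and `rowB`. The width n + 1 includes the separator.
open Polynomial in
theorem computedBy_inA (x : α) :
    ComputedBy (inA x : Fml α β) (readCell (.num .rowA) x)
      ((X + 1) * (9 * (X + 1) + 6) + 9 * X + 9) := by
  intro I e ρ L κ r _
  refine (does_readCell (by simp) x I _ ρ L κ r I.n rfl _
    (getElem?_encodeInput_A I (e x)) (by omega) (by simp)).mono ?_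
  simp

open Polynomial in
theorem computedBy_inB (x : α) :
    ComputedBy (inB x : Fml α β) (readCell (.num .rowB) x)
      ((X + 1) * (9 * (X + 1) + 6) + 9 * X + 9) := by
  intro I e ρ L κ r _
  refine (does_readCell (by simp) x I _ ρ L κ r (I.n + 1) rfl _
    (getElem?_encodeInput_B I (e x)) (by omega) (by simp)).mono ?_
  simp

theorem some_eq_bit {P : Prop} {a : Bool} (h : a = true ↔ P) : some a = bit P := by
  rw [bit]
  congr 1
  rw [Bool.eq_iff_iff]
  simpa using h

/-- The truth value of the statement that a bit list contains a certain element. -/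
def memSym (v : Acc) : Sym := some (decide (v = some (some true)))

/-- The truth value of the statement that a counter is exhausted. -/
def leSym (v : Acc) : Sym := some v.isNone

open Polynomial in
theorem computedBy_mem (i : Bool) (b : β) (x : α) :
    ComputedBy (mem i b x : Fml α β)
      (lookup (.var x) (.set b i) .tmp .aux₁ .res memSym) (9 * X + 7) := by
  intro I e ρ L κ r _
  have h := does_lookup (config I (fun a => (e a : ℕ)) ρ L κ r) (x := .var x) (a := .set b i)
    (b := .tmp) (t := .aux₁) (r := .res) (by simp) (by simp) (by simp) memSym (e x) rfl rfl rfl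
  refine (h.mono (by simp)).of_eq rfl ?_
  rw [update_config_res]
  congr 2
  refine some_eq_bit ?_
  rw [decide_eq_true_iff]
  cases i <;> exact Iff.rfl

open Polynomial in
theorem computedBy_le {x y : α} (hxy : x ≠ y) :
    ComputedBy (le x y : Fml α β)
      (lookup (.var y) (.var x) .tmp .aux₁ .res leSym) (9 * X + 7) := by
  intro I e ρ L κ r _
  have h := does_lookup (config I (fun a => (e a : ℕ)) ρ L κ r) (x := .var y) (a := .var x)
    (b := .tmp) (t := .aux₁) (r := .res) (by simp [hxy.symm]) (by simp) (by simp) leSym (e y)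
    rfl rfl rfl
  refine (h.mono (by simp)).of_eq rfl ?_
  rw [update_config_res]
  congr 2
  refine some_eq_bit ?_
  simp [config, eval]

/-- This case is separate because a lookup needs two different stacks. -/
theorem computedBy_le_self (x : α) :
    ComputedBy (le x x : Fml α β) (put .res (some true)) 1 := by
  intro I e ρ L κ r _
  refine ((does_put _ _ _).mono (by simp)).of_eq rfl ?_
  rw [update_config_res]
  simp [config, bit, eval]

end Atoms

section Connectives

theorem Fresh.neg {φ : Fml α β} {e ρ : α → ℕ} {L : β → Bool → List Sym} {κ : β → ℕ}
    (h : (neg φ).Fresh e ρ L κ) : φ.Fresh e ρ L κ := h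

theorem Fresh.left {φ ψ : Fml α β} {e ρ : α → ℕ} {L : β → Bool → List Sym} {κ : β → ℕ}
    (h : (φ.and ψ).Fresh e ρ L κ) : φ.Fresh e ρ L κ :=
  ⟨fun x hx => h.1 x (by simp [bindsVar, hx]), fun b hb => h.2 b (by simp [bindsSet, hb])⟩

theorem Fresh.right {φ ψ : Fml α β} {e ρ : α → ℕ} {L : β → Bool → List Sym} {κ : β → ℕ}
    (h : (φ.and ψ).Fresh e ρ L κ) : ψ.Fresh e ρ L κ :=
  ⟨fun x hx => h.1 x (by simp [bindsVar, hx]), fun b hb => h.2 b (by simp [bindsSet, hb])⟩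

/-- In a loop over x the stacks of x are in use; a subformula that does not bind x again is not
disturbed. This is what well-formedness is for. -/
theorem Fresh.update_var {φ : Fml α β} {e ρ : α → ℕ} {L : β → Bool → List Sym} {κ : β → ℕ}
    (h : φ.Fresh e ρ L κ) {x : α} (hx : bindsVar φ x = false) (i j : ℕ) :
    φ.Fresh (Function.update e x i) (Function.update ρ x j) L κ := by
  refine ⟨fun y hy => ?_, h.2⟩
  have hyx : y ≠ x := by
    rintro rfl
    simp [hx] at hy
  simpa [hyx] using h.1 y hy

theorem Fresh.update_set {φ : Fml α β} {e ρ : α → ℕ} {L : β → Bool → List Sym} {κ : β → ℕ}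
    (h : φ.Fresh e ρ L κ) {b : β} (hb : bindsSet φ b = false) (l : Bool → List Sym) (j : ℕ) :
    φ.Fresh e ρ (Function.update L b l) (Function.update κ b j) := by
  refine ⟨h.1, fun c hc => ?_⟩
  have hcb : c ≠ b := by
    rintro rfl
    simp [hb] at hc
  simpa [hcb] using h.2 c hc

/-- Pop a truth value and run the first program if it is true, and the second one otherwise. -/
def ifTop (p q : Prog (Stk α β)) : Prog (Stk α β) :=
  seq (pop .res) (ite (fun v => v == some (some true)) p q)

theorem does_ifTop {P : Prop} {p q : Prog (Stk α β)} {I : Input} {e ρ : α → ℕ}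
    {L : β → Bool → List Sym} {κ : β → ℕ} {r r' : List Sym} {T : ℕ}
    (hp : P → Does p (config I e ρ L κ r) (config I e ρ L κ r') T)
    (hq : ¬ P → Does q (config I e ρ L κ r) (config I e ρ L κ r') T) :
    Does (ifTop p q) (config I e ρ L κ (bit P :: r)) (config I e ρ L κ r') (T + 2) := by
  intro v o
  have h := runs_pop (⟨v, config I e ρ L κ (bit P :: r), o⟩ : Store (Stk α β)) .res
  have h' := h.cast (S'' := config I e ρ L κ r) (update_config_res I e ρ L κ (bit P :: r) r) le_rfl
  by_cases hP : P
  · obtain ⟨v', h2⟩ := hp hP (config I e ρ L κ (bit P :: r) .res).head? o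
    exact ⟨v', (h'.seq (Runs.ite_true (by simp [config, bit, hP]) h2)).mono (by omega)⟩
  · obtain ⟨v', h2⟩ := hq hP (config I e ρ L κ (bit P :: r) .res).head? o
    exact ⟨v', (h'.seq (Runs.ite_false (by simp [config, bit, hP]) h2)).mono (by omega)⟩

theorem does_put_bit (P : Prop) (a : Bool) (ha : a = true ↔ P) (I : Input) (e ρ : α → ℕ)
    (L : β → Bool → List Sym) (κ : β → ℕ) (r : List Sym) :
    Does (put .res (some a)) (config I e ρ L κ r) (config I e ρ L κ (bit P :: r)) 1 := by
  refine (does_put _ _ _).of_eq rfl ?_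
  rw [update_config_res]
  congr 2
  exact some_eq_bit ha

theorem does_pop_res (a : Sym) (I : Input) (e ρ : α → ℕ)
    (L : β → Bool → List Sym) (κ : β → ℕ) (r : List Sym) :
    Does (pop .res) (config I e ρ L κ (a :: r)) (config I e ρ L κ r) 1 :=
  (does_pop _ _).of_eq rfl (update_config_res _ _ _ _ _ _ _)

theorem ComputedBy.neg {φ : Fml α β} {p : Prog (Stk α β)} {T : Polynomial ℕ}
    (h : ComputedBy φ p T) :
    ComputedBy (neg φ) (seq p (ifTop (put .res (some false)) (put .res (some true)))) (T + 3) := by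
  intro I e ρ L κ r hf
  refine ((h I e ρ L κ r hf.neg).seq (does_ifTop (fun hP => does_put_bit _ _ ?_ _ _ _ _ _ _)
    (fun hP => does_put_bit _ _ ?_ _ _ _ _ _ _))).mono (by simp)
  · simpa [eval] using hP
  · simpa [eval] using hP

/-- The value of ψ is on top of that of φ. If ψ holds, the value of φ is the result and stays;
otherwise it is replaced by false. -/
theorem ComputedBy.and {φ ψ : Fml α β} {p q : Prog (Stk α β)} {T U : Polynomial ℕ}
    (hφ : ComputedBy φ p T) (hψ : ComputedBy ψ q U) :
    ComputedBy (φ.and ψ) (seq p (seq q (ifTop skip (seq (pop .res) (put .res (some false))))))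
      (T + U + 4) := by
  intro I e ρ L κ r hf
  refine ((hφ I e ρ L κ r hf.left).seq ((hψ I e ρ L κ _ hf.right).seq
    (does_ifTop (T := 2) (fun hP => ?_) (fun hP => ?_)))).mono (by simp; omega)
  · refine ((does_skip _).mono (by omega)).of_eq rfl ?_
    congr 2
    simp only [eval, hP, and_true]
  · exact (does_pop_res _ _ _ _ _ _ _).seq
      (does_put_bit _ _ (by simp [eval, hP]) _ _ _ _ _ _)

open Polynomial in
theorem ComputedBy.ex {φ : Fml α β} {p : Prog (Stk α β)} {T : Polynomial ℕ} {x : α}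
    (h : ComputedBy φ p T) (hx : bindsVar φ x = false) :
    ComputedBy (ex x φ) (seq (put .res (some false))
      (forVertex x (seq p (ifTop (seq (pop .res) (put .res (some true))) skip))))
      (X * (T + 6) + 7 * X + 5) := by
  intro I e ρ L κ r hf
  have h0 := hf.1 x (by simp [bindsVar])
  have hf' : φ.Fresh (fun a => (e a : ℕ)) ρ L κ :=
    ⟨fun y hy => hf.1 y (by simp [bindsVar, hy]), fun b hb => hf.2 b (by simpa [bindsSet] using hb)⟩
  have h2 := does_forVertex (I := I) (L := L) (κ := κ)
    (p := seq p (ifTop (seq (pop .res) (put .res (some true))) skip)) (T := T.eval I.n + 4)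
    -- The symbol on top of r records whether a witness below i has been found.
    (fun i => bit (∃ j : Fin I.n, (j : ℕ) < i ∧
      φ.eval I (Function.update e x j) (setEnv I.n L)) :: r) h0.1 h0.2 (by
      intro i hi
      have hp := h I (Function.update e x ⟨i, hi⟩) (Function.update ρ x (I.n - 1 - i)) L κ
        (bit (∃ j : Fin I.n, (j : ℕ) < i ∧ φ.eval I (Function.update e x j) (setEnv I.n L)) :: r)
        (by rw [val_update]; exact hf'.update_var hx _ _)
      rw [val_update] at hp
      refine (hp.seq (does_ifTop (T := 2) (fun hP => ?_) (fun hP => ?_)))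
      · refine (does_pop_res _ _ _ _ _ _ _).seq (does_put_bit _ _ ?_ _ _ _ _ _ _)
        simp only [true_iff]
        exact ⟨⟨i, hi⟩, Nat.lt_succ_self i, hP⟩
      · refine ((does_skip _).mono (by omega)).of_eq rfl ?_
        congr 3
        refine propext ⟨fun ⟨j, hj, hφ⟩ => ⟨j, by omega, hφ⟩, fun ⟨j, hj, hφ⟩ => ⟨j, ?_, hφ⟩⟩
        rcases Nat.lt_succ_iff_lt_or_eq.1 hj with hlt | heq
        · exact hlt
        · exact absurd (by rwa [show j = ⟨i, hi⟩ from Fin.ext heq] at hφ) hP)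
  refine (((does_put_bit (∃ j : Fin I.n, (j : ℕ) < 0 ∧
    φ.eval I (Function.update e x j) (setEnv I.n L)) false (by simp) _ _ _ _ _ _).seq h2).mono
    ?_).of_eq rfl ?_
  · simp
    ring_nf
    omega
  · congr 2
    simp [eval]

end Connectives

end Fml

end Monophonic

/-! ### Evaluating fixed points. -/

namespace Monophonic

open Prog

variable {α β : Type}

namespace Fml

variable [DecidableEq α] [DecidableEq β]

section Fix

/-- The symbols of the characteristic vector of a set. -/
noncomputable def syms {n : ℕ} (S : Set (Fin n)) : List Sym := (bits S).map some

/-- Evaluating a formula for all values of a variable yields a characteristic vector. -/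
theorem ComputedBy.does_forVertex {φ : Fml α β} {p : Prog (Stk α β)} {T : Polynomial ℕ} {x : α}
    (h : ComputedBy φ p T) (hx : bindsVar φ x = false) {I : Input}
    {e' : α → ℕ} {ρ : α → ℕ} {L : β → Bool → List Sym} {κ : β → ℕ} (r : List Sym)
    (env : Fin I.n → α → Fin I.n)
    (henv : ∀ i, (fun a => (env i a : ℕ)) = Function.update e' x i)
    (he : e' x = 0) (hρ : ρ x = 0) (hf : φ.Fresh e' ρ L κ) :
    Does (forVertex x p) (config I e' ρ L κ r)
      (config I e' ρ L κ ((syms {i | φ.eval I (env i) (setEnv I.n L)}).reverse ++ r))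
      (I.n * (T.eval I.n + 2) + 7 * I.n + 4) := by
  have hlen : (syms {i | φ.eval I (env i) (setEnv I.n L)}).length = I.n := length_map_bits _
  have h2 := Monophonic.does_forVertex (I := I) (L := L) (κ := κ) (p := p) (T := T.eval I.n)
    (fun i => ((syms {i | φ.eval I (env i) (setEnv I.n L)}).take i).reverse ++ r) he hρ (by
      intro i hi
      have hp := h I (env ⟨i, hi⟩) (Function.update ρ x (I.n - 1 - i)) L κ
        (((syms {i | φ.eval I (env i) (setEnv I.n L)}).take i).reverse ++ r)
        (by rw [henv]; exact hf.update_var hx _ _)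
      rw [henv] at hp
      refine hp.of_eq rfl ?_
      congr 1
      rw [List.take_add_one, List.getElem?_eq_getElem (by omega)]
      simp [syms, bits, bit])
  refine h2.of_eq (by simp) ?_
  congr 2
  rw [List.take_of_length_le hlen.le]

/-- Move a characteristic vector from the stack for results to the stack of a set variable. -/
def store (b : β) (i : Bool) : Prog (Stk α β) :=
  seq (clear (.set b i)) (seek (.num .size) .res (.set b i) .aux₁)

/-- The vector arrives with its last entry on top; moving n symbols restores the order and leaves r
untouched. -/
theorem does_store (b : β) (i : Bool) (I : Input) (e ρ : α → ℕ) (L : β → Bool → List Sym)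
    (κ : β → ℕ) (r : List Sym) (S : Set (Fin I.n)) (hl : (L b i).length ≤ I.n) :
    Does (store b i) (config I e ρ L κ ((syms S).reverse ++ r))
      (config I e ρ (Function.update L b (Function.update (L b) i (syms S))) κ r)
      (9 * I.n + 3) := by
  have hlen : (syms S).length = I.n := length_map_bits S
  have h1 := (does_clear (config I e ρ L κ ((syms S).reverse ++ r)) (.set b i)).of_eq rfl
    (update_config_set I e ρ L κ _ b i [])
  have h2 := does_seek (config I e ρ (Function.update L b (Function.update (L b) i [])) κ
    ((syms S).reverse ++ r)) (x := .num .size) (a := .res) (b := .set b i) (t := .aux₁)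
    (by simp) I.n rfl rfl
  refine ((h1.seq h2).mono ?_).of_eq rfl ?_
  · simp only [config]
    omega
  · rw [update_config_res, update_config_set]
    simp only [config, Function.update_self, Function.update_idem]
    rw [List.drop_append_of_le_length (by simp [hlen]), List.take_append_of_le_length
      (by simp [hlen]), List.drop_of_length_le (by simp [hlen]),
      List.take_of_length_le (by simp [hlen])]
    simp

/-- One step of a fixed point iteration. -/
def fixBody (b : β) (x : α) (p q : Prog (Stk α β)) : Prog (Stk α β) :=
  seq (forVertex x p) (seq (forVertex x q) (seq (store b true) (store b false)))

theorem Fresh.of_fix {b : β} {x : α} {φ ψ χ θ : Fml α β} {e ρ : α → ℕ}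
    {L : β → Bool → List Sym} {κ : β → ℕ} (h : (fix b x φ ψ χ).Fresh e ρ L κ)
    (hθ : θ = φ ∨ θ = ψ ∨ θ = χ) : θ.Fresh e ρ L κ := by
  refine ⟨fun y hy => h.1 y ?_, fun c hc => h.2 c ?_⟩
  · rcases hθ with rfl | rfl | rfl <;> simp [bindsVar, hy]
  · rcases hθ with rfl | rfl | rfl <;> simp [bindsSet, hc]

open Polynomial in
theorem ComputedBy.fix {φ ψ χ : Fml α β} {p q s : Prog (Stk α β)} {T U W : Polynomial ℕ} {b : β}
    {x : α} (hφ : ComputedBy φ p T) (hψ : ComputedBy ψ q U) (hχ : ComputedBy χ s W)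
    (hxφ : bindsVar φ x = false) (hxψ : bindsVar ψ x = false) (hbφ : bindsSet φ b = false)
    (hbψ : bindsSet ψ b = false) (hbχ : bindsSet χ b = false) :
    ComputedBy (fix b x φ ψ χ)
      (seq (copy (.num .twice) (.iter b) .aux₁) (seq (repeatFor (.iter b) (fixBody b x p q))
        (seq s (seq (clear (.set b true)) (clear (.set b false))))))
      (10 * X + 2 + (2 * X * (X * (T + 2) + X * (U + 2) + 32 * X + 15) + 1) + W + 4 * X + 2) := by
  intro I e ρ L κ r hf
  have hx := hf.1 x (by simp [bindsVar])
  obtain ⟨hLb, hκb⟩ := hf.2 b (by simp [bindsSet])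
  have hfφ := hf.of_fix (θ := φ) (by simp)
  have hfψ := hf.of_fix (θ := ψ) (by simp)
  have hfχ := hf.of_fix (θ := χ) (by simp)
  have hκ : Function.update κ b 0 = κ := by rw [← hκb, Function.update_eq_self]
  set F := fun S : Set (Fin I.n) × Set (Fin I.n) =>
    ({i | eval I φ (Function.update e x i) (Function.update (setEnv I.n L) b S)},
      {i | eval I ψ (Function.update e x i) (Function.update (setEnv I.n L) b S)}) with hF
  -- Before the first round the stacks are empty, as freshness demands, and an empty list already
  -- denotes ∅. Later they hold vectors of length n.
  let M : ℕ → Bool → List Sym := fun k i => if k = 0 then [] else syms (side i (F^[k] (∅, ∅)))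
  have hMlen : ∀ k i, (M k i).length ≤ I.n := by
    intro k i
    simp only [M]
    split_ifs
    · simp
    · exact (length_map_bits _).le
  have hMset : ∀ k, setEnv I.n (Function.update L b (M k)) =
      Function.update (setEnv I.n L) b (F^[k] (∅, ∅)) := by
    intro k
    rw [setEnv_update]
    congr 1
    simp only [M]
    split_ifs with h
    · simp [h, toSet_nil]
    · simp only [syms, toSet_map_bits, side]
      rfl
  have hM0 : Function.update L b (M 0) = L := by
    rw [show M 0 = L b from funext fun i => by simp [M, hLb i], Function.update_eq_self]
  have h1 : Does (copy (.num .twice) (.iter b) .aux₁) (config I (fun a => (e a : ℕ)) ρ L κ r)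
      (config I (fun a => (e a : ℕ)) ρ L (Function.update κ b (2 * I.n)) r) (10 * I.n + 2) :=
    ((does_copy (config I (fun a => (e a : ℕ)) ρ L κ r) (by simp) (by simp) (by simp) (2 * I.n)
      rfl rfl).mono (by omega)).of_eq rfl
      (update_config_iter _ _ _ _ _ _ _ _ _ (by simp [config, hκb]))
  have h2 := does_repeatFor (k := .iter b) (p := fixBody b x p q)
    (T := I.n * (T.eval I.n + 2) + I.n * (U.eval I.n + 2) + 32 * I.n + 14) (2 * I.n)
    (fun k => config I (fun a => (e a : ℕ)) ρ (Function.update L b (M k))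
      (Function.update κ b (2 * I.n - k)) r) (by simp [config]) (by
      intro k hk
      -- Both new sets are computed from the old pair before either is stored. The second lies on
      -- top and is stored first.
      have a1 := hφ.does_forVertex hxφ r (I := I) (e' := fun a => (e a : ℕ)) (ρ := ρ)
        (L := Function.update L b (M k)) (κ := Function.update κ b (2 * I.n - k - 1))
        (fun i => Function.update e x i) (fun i => val_update e x i) hx.1 hx.2
        (hfφ.update_set hbφ _ _)
      have a2 := hψ.does_forVertex hxψ ((syms {i | φ.eval I (Function.update e x i)
          (setEnv I.n (Function.update L b (M k)))}).reverse ++ r)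
        (I := I) (e' := fun a => (e a : ℕ)) (ρ := ρ)
        (L := Function.update L b (M k)) (κ := Function.update κ b (2 * I.n - k - 1))
        (fun i => Function.update e x i) (fun i => val_update e x i) hx.1 hx.2
        (hfψ.update_set hbψ _ _)
      have a3 := does_store b true I (fun a => (e a : ℕ)) ρ (Function.update L b (M k))
        (Function.update κ b (2 * I.n - k - 1)) ((syms {i | φ.eval I (Function.update e x i)
          (setEnv I.n (Function.update L b (M k)))}).reverse ++ r)
        {i | ψ.eval I (Function.update e x i) (setEnv I.n (Function.update L b (M k)))}
        (by rw [Function.update_self]; exact hMlen k true)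
      have a4 := does_store b false I (fun a => (e a : ℕ)) ρ (Function.update (Function.update L b
          (M k)) b (Function.update (Function.update L b (M k) b) true (syms {i | ψ.eval I
            (Function.update e x i) (setEnv I.n (Function.update L b (M k)))})))
        (Function.update κ b (2 * I.n - k - 1)) r
        {i | φ.eval I (Function.update e x i) (setEnv I.n (Function.update L b (M k)))}
        (by simpa using hMlen k false)
      refine ((a1.seq (a2.seq (a3.seq a4))).mono ?_).of_eq ?_ ?_
      · ring_nf
        omega
      · rw [update_config_iter (m := 2 * I.n - k - 1) (hl := by simp [config])]
        simp
      · rw [Nat.sub_sub]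
        congr 1
        simp only [Function.update_idem, Function.update_self]
        congr 1
        rw [hMset]
        funext i
        cases i
        · simp only [Function.update_self, M, Nat.add_one_ne_zero, if_false, side, cond_false]
          rw [Function.iterate_succ_apply']
        · rw [Function.update_of_ne (by simp)]
          simp only [Function.update_self, M, Nat.add_one_ne_zero, if_false, side, cond_true]
          rw [Function.iterate_succ_apply'])
  have h3 := hχ I e ρ (Function.update L b (M (2 * I.n))) κ r (by
    have := hfχ.update_set hbχ (M (2 * I.n)) 0
    rwa [hκ] at this)
  have h4 := fun r' => (does_clear (config I (fun a => (e a : ℕ)) ρ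
    (Function.update L b (M (2 * I.n))) κ r') (.set b true)).of_eq rfl
      (update_config_set _ _ _ _ _ _ _ _ _)
  have h5 := fun r' => (does_clear (config I (fun a => (e a : ℕ)) ρ
    (Function.update (Function.update L b (M (2 * I.n))) b (Function.update
      (Function.update L b (M (2 * I.n)) b) true [])) κ r') (.set b false)).of_eq rfl
      (update_config_set _ _ _ _ _ _ _ _ _)
  refine ((h1.seq ((h2.of_eq ?_ ?_).seq (h3.seq ((h4 _).seq (h5 _))))).mono ?_).of_eq rfl ?_
  · simp only [hM0, Nat.sub_zero]
  · simp only [Nat.sub_self, hκ]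
  · have l1 := hMlen (2 * I.n) true
    have l2 := hMlen (2 * I.n) false
    simp only [config, Function.update_self, ne_eq, Bool.false_eq_true, not_false_eq_true,
      Function.update_of_ne]
    generalize (M (2 * I.n) true).length = m₁ at *
    generalize (M (2 * I.n) false).length = m₂ at *
    simp
    ring_nf
    omega
  · rw [hMset]
    congr 1
    simp only [Function.update_idem, Function.update_self]
    funext c
    by_cases hc : c = b
    · subst hc
      rw [Function.update_self]
      funext i
      cases i <;> simp [hLb]
    · rw [Function.update_of_ne hc]

/-- Every well-formed formula is evaluated by a program in polynomial time. -/
theorem exists_computedBy (φ : Fml α β) (h : φ.wellFormed = true) :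
    ∃ p T, ComputedBy φ p T := by
  induction φ with
  | inA x => exact ⟨_, _, computedBy_inA x⟩
  | inB x => exact ⟨_, _, computedBy_inB x⟩
  | edge x y => exact ⟨_, _, computedBy_edge x y⟩
  | le x y =>
    by_cases hxy : x = y
    · subst hxy
      exact ⟨_, _, computedBy_le_self x⟩
    · exact ⟨_, _, computedBy_le hxy⟩
  | mem i b x => exact ⟨_, _, computedBy_mem i b x⟩
  | neg φ ih =>
    obtain ⟨p, T, hp⟩ := ih h
    exact ⟨_, _, hp.neg⟩
  | and φ ψ ihφ ihψ =>
    simp only [wellFormed, Bool.and_eq_true] at h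
    obtain ⟨p, T, hp⟩ := ihφ h.1
    obtain ⟨q, U, hq⟩ := ihψ h.2
    exact ⟨_, _, hp.and hq⟩
  | ex x φ ih =>
    simp only [wellFormed, Bool.and_eq_true, Bool.not_eq_true'] at h
    obtain ⟨p, T, hp⟩ := ih h.2
    exact ⟨_, _, hp.ex h.1⟩
  | fix b x φ ψ χ ihφ ihψ ihχ =>
    simp only [wellFormed, Bool.and_eq_true, Bool.not_eq_true'] at h
    obtain ⟨⟨⟨⟨⟨⟨⟨h1, h2⟩, h3⟩, h4⟩, h5⟩, h6⟩, h7⟩, h8⟩ := h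
    obtain ⟨p, T, hp⟩ := ihφ h6
    obtain ⟨q, U, hq⟩ := ihψ h7
    obtain ⟨s, W, hs⟩ := ihχ h8
    exact ⟨_, _, hp.fix hq hs h1 h2 h3 h4 h5⟩

end Fix

end Fml

end Monophonic

/-! ### The complete machine: reading the input, evaluation, output. -/

namespace Monophonic

open Prog

variable {α β : Type}

section TopLevel

variable [DecidableEq α] [DecidableEq β]

/-- The stack contents while the counters are computed. -/
def initConfig (l d : List Sym) (m : Counter → ℕ) : Stk α β → List Sym
  | .inp => l
  | .tmp => d
  | .num c => List.replicate (m c) none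
  | _ => []

theorem update_initConfig_inp (l d l' : List Sym) (m : Counter → ℕ) :
    Function.update (initConfig (α := α) (β := β) l d m) .inp l' = initConfig l' d m := by
  funext j
  cases j <;> simp [initConfig]

theorem update_initConfig_tmp (l d l' : List Sym) (m : Counter → ℕ) :
    Function.update (initConfig (α := α) (β := β) l d m) .tmp l' = initConfig l l' m := by
  funext j
  cases j <;> simp [initConfig]

theorem does_inc (l d : List Sym) (m : Counter → ℕ) (c : Counter) :
    Does (put (.num c) none) (initConfig (α := α) (β := β) l d m)
      (initConfig l d (Function.update m c (m c + 1))) 1 := by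
  refine (does_put _ _ _).of_eq rfl ?_
  funext j
  cases j <;> simp [initConfig, Function.update_apply]
  split_ifs with h
  · subst h
    rw [List.replicate_succ]
  · rfl

/-- Increase the counters for one symbol in the first row. -/
def incAll : Prog (Stk α β) :=
  seq (put (.num .size) none) (seq (put (.num .width) none) (seq (put (.num .rowA) none)
    (seq (put (.num .rowB) none) (seq (put (.num .twice) none) (put (.num .twice) none)))))

/-- The values of the counters after reading `k` symbols of the first row. -/
def partialCount (k : ℕ) : Counter → ℕ
  | .twice => 2 * k
  | _ => k

theorem does_incAll (l d : List Sym) (k : ℕ) :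
    Does incAll (initConfig (α := α) (β := β) l d (partialCount k))
      (initConfig l d (partialCount (k + 1))) 6 := by
  refine ((does_inc _ _ _ _).seq ((does_inc _ _ _ _).seq ((does_inc _ _ _ _).seq
    ((does_inc _ _ _ _).seq ((does_inc _ _ _ _).seq (does_inc _ _ _ _)))))).of_eq rfl ?_
  congr 1
  funext c
  cases c <;> simp [partialCount]
  omega

/-- Read the first row and count its symbols. -/
def countRow : Prog (Stk α β) :=
  loop .inp (fun v => (v.getD none).isSome) (seq (push .tmp fun v => v.getD none) incAll)

theorem does_countRow (bs : List Bool) (l d : List Sym) (k : ℕ) :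
    Does countRow
      (initConfig (α := α) (β := β) (bs.map some ++ none :: l) d (partialCount k))
      (initConfig l ((bs.map some).reverse ++ d) (partialCount (k + bs.length)))
      (8 * bs.length + 1) := by
  induction bs generalizing d k with
  | nil =>
    intro v o
    have h := runs_loop_exit (k := (.inp : Stk α β)) (c := fun v => (v.getD none).isSome)
      (p := seq (push .tmp fun v => v.getD none) incAll)
      (s := ⟨v, initConfig (none :: l) d (partialCount k), o⟩) rfl
    exact ⟨_, h.cast (update_initConfig_inp _ _ _ _) (by simp)⟩
  | cons a bs ih =>
    intro v o
    have h1 := runs_push (⟨some (some a), initConfig (bs.map some ++ none :: l) d (partialCount k),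
      o⟩ : Store (Stk α β)) .tmp (fun v => v.getD none)
    have h1' := h1.cast (update_initConfig_tmp _ _ _ _) le_rfl
    obtain ⟨v', h2⟩ := does_incAll (α := α) (β := β) (bs.map some ++ none :: l) (some a :: d) k
      (some (some a)) o
    obtain ⟨v'', h3⟩ := ih (some a :: d) (k + 1) v' o
    have h0 : Function.update (initConfig (α := α) (β := β) ((a :: bs).map some ++ none :: l) d
        (partialCount k)) .inp (bs.map some ++ none :: l) =
        initConfig (bs.map some ++ none :: l) d (partialCount k) := update_initConfig_inp _ _ _ _
    refine ⟨v'', (Runs.loop_step (t := 7) rfl ?_ h3).cast ?_ ?_⟩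
    · have := h1'.seq h2
      rw [← h0] at this
      exact this
    · simp [Nat.add_assoc, Nat.add_comm 1]
    · simp
      omega

/-- Compute all counters and restore the input. -/
def setup : Prog (Stk α β) :=
  seq countRow (seq (put .inp none) (seq (put (.num .width) none) (seq (put (.num .rowB) none)
    (move .tmp .inp))))

/-- The number n is read off the first row. For n = 0 there are no matrix rows, and the first row is
the empty one of A. -/
theorem exists_encodeInput_eq (I : Input) : ∃ (bs : List Bool) (l : List Sym),
    bs.length = I.n ∧ encodeInput I = bs.map some ++ none :: l := by
  have hrow : ∀ (S : Set (Fin I.n)) (l : List Sym), ∃ (bs : List Bool) (l' : List Sym),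
      bs.length = I.n ∧ row S ++ l = bs.map some ++ none :: l' :=
    fun S l => ⟨bits S, l, by simp [bits], by simp [row]⟩
  obtain ⟨n, G, A, B⟩ := I
  cases n with
  | zero =>
    have : encodeInput ⟨0, G, A, B⟩ = row A ++ row B := by simp [encodeInput]
    rw [this]
    exact hrow A _
  | succ n =>
    rw [encodeInput, List.ofFn_succ, List.flatten_cons, List.append_assoc, List.append_assoc]
    exact hrow _ _

/-- Counting the first row gives n on all counters except 2n on `twice`; `width` and `rowB` get one
more. Then the separator and the row are put back. -/
theorem does_setup (I : Input) :
    Does (setup (α := α) (β := β)) (Function.update (fun _ => []) .inp (encodeInput I))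
      (config I (fun _ => 0) (fun _ => 0) (fun _ _ => []) (fun _ => 0) []) (10 * I.n + 5) := by
  obtain ⟨bs, l, hlen, henc⟩ := exists_encodeInput_eq I
  have h1 := does_countRow (α := α) (β := β) bs l [] 0
  have h2 := (does_put (initConfig (α := α) (β := β) l ((bs.map some).reverse ++ [])
    (partialCount (0 + bs.length))) .inp none).of_eq rfl (update_initConfig_inp _ _ _ _)
  refine ((h1.seq (h2.seq ((does_inc _ _ _ _).seq ((does_inc _ _ _ _).seq
    (does_move _ (by simp)))))).mono ?_).of_eq ?_ ?_
  · simp [initConfig, hlen]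
    omega
  · rw [henc]
    funext j
    cases j <;> simp [initConfig, partialCount]
    rename_i c
    cases c <;> rfl
  · funext j
    cases j <;> simp [initConfig, config, henc]
    rename_i c
    cases c <;> simp [partialCount, Counter.value, hlen]

/-- Write the results to the output stack. -/
def emit : Prog (Stk α β) :=
  loop .res Option.isSome (out fun v => v == some (some true))

/-- The results have the last vertex on top, and pushing them one by one on the output stack
reverses them into the required order. -/
theorem runs_emit (I : Input) (e ρ : α → ℕ) (L : β → Bool → List Sym) (κ : β → ℕ)
    (bs : List Bool) (v : Acc) (o : List Bool) :
    ∃ v', Runs emit ⟨v, config I e ρ L κ (bs.map some), o⟩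
      ⟨v', config I e ρ L κ [], bs.reverse ++ o⟩ (2 * bs.length + 1) := by
  induction bs generalizing v o with
  | nil =>
    have h := runs_loop_exit (k := (.res : Stk α β)) (c := Option.isSome)
      (p := out fun v => v == some (some true)) (s := ⟨v, config I e ρ L κ [], o⟩) rfl
    exact ⟨_, h.cast (update_config_res _ _ _ _ _ _ _) (by simp)⟩
  | cons a bs ih =>
    obtain ⟨v', h2⟩ := ih (some (some a)) (a :: o)
    have h1 := runs_out (⟨some (some a), config I e ρ L κ (bs.map some), o⟩ : Store (Stk α β))
      (fun v => v == some (some true))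
    have h0 : Function.update (config I e ρ L κ ((a :: bs).map some)) .res (bs.map some) =
        config I e ρ L κ (bs.map some) := update_config_res _ _ _ _ _ _ _
    change Runs (loop (Stk.res : Stk α β) Option.isSome (out fun v => v == some (some true))) _ _ _ at h2
    have h3 := Runs.loop_step (k := .res) (c := Option.isSome)
      (p := out fun v => v == some (some true)) (s := ⟨v, config I e ρ L κ ((a :: bs).map some), o⟩)
      (s' := ⟨some (some a), config I e ρ L κ (bs.map some), a :: o⟩) (t := 1) rfl (by
        have : ((some (some a) : Acc) == some (some true)) = a := by cases a <;> rfl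
        simp only [this, ← h0] at h1
        rw [← h0]
        exact h1) h2
    refine ⟨v', ?_⟩
    have e1 : (a :: bs).reverse ++ o = bs.reverse ++ a :: o := by simp
    rw [e1]
    exact h3.mono (by simp; omega)

/-- Empty the stacks that are not empty after the evaluation. -/
def cleanup : Prog (Stk α β) :=
  seq (clear .inp) (seq (clear (.num .size)) (seq (clear (.num .width)) (seq (clear (.num .rowA))
    (seq (clear (.num .rowB)) (clear (.num .twice))))))

theorem does_cleanup (I : Input) :
    Does (cleanup (α := α) (β := β))
      (config I (fun _ => 0) (fun _ => 0) (fun _ _ => []) (fun _ => 0) []) (fun _ => [])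
      (2 * ((I.n + 2) * (I.n + 1)) + 12 * I.n + 10) := by
  refine (((does_clear _ _).seq ((does_clear _ _).seq ((does_clear _ _).seq ((does_clear _ _).seq
    ((does_clear _ _).seq (does_clear _ _)))))).mono ?_).of_eq rfl ?_
  · simp [config, Counter.value, length_encodeInput]
    omega
  · funext j
    cases j with
    | num c => cases c <;> rfl
    | _ => rfl

/-- Running times are polynomials in n, whereas the bound is in terms of the input length, which is
at least n. -/
theorem eval_mono_nat (T : Polynomial ℕ) {a b : ℕ} (h : a ≤ b) : T.eval a ≤ T.eval b := by
  rw [Polynomial.eval_eq_sum_range, Polynomial.eval_eq_sum_range]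
  gcongr

/-- The set of vertices that is defined by a formula. -/
def Fml.output (φ : Fml α β) (x : α) (I : Input) : Set (Fin I.n) :=
  {i | φ.eval I (Function.update (fun _ => ⟨0, i.pos⟩) x i) fun _ => (∅, ∅)}

open Polynomial in
/-- The set of vertices that is defined by a formula is computable in polynomial time. -/
theorem Fml.polyTimeComputable [Fintype α] [Fintype β] (φ : Fml α β) (h : φ.wellFormed = true)
    (x : α) (hx : φ.bindsVar x = false) :
    PolyTimeComputable fun I => ⟨I.n, φ.output x I⟩ := by
  obtain ⟨p, T, hp⟩ := φ.exists_computedBy h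
  refine polyTimeComputable_of_runs _
    (seq setup (seq (forVertex x p) (seq emit cleanup))) .inp
    (10 * X + 5 + (X * (T + 2) + 7 * X + 4) + (2 * X + 1) +
      (2 * ((X + 2) * (X + 1)) + 12 * X + 10)) fun I => ?_
  -- For n = 0 there is no assignment of vertices to the variables; a default assignment is
  -- available only once a vertex i is given.
  have h2 := hp.does_forVertex hx [] (I := I) (e' := fun _ => 0) (ρ := fun _ => 0)
    (L := fun _ _ => []) (κ := fun _ => 0)
    (fun i => Function.update (fun _ => ⟨0, i.pos⟩) x i) (fun i => val_update _ x i) rfl rfl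
    ⟨fun _ _ => ⟨rfl, rfl⟩, fun _ _ => ⟨fun _ => rfl, rfl⟩⟩
  have hset : setEnv I.n (fun (_ : β) _ => []) = fun _ => (∅, ∅) := by
    funext b
    simp [setEnv, toSet_nil]
  have hbits : (syms {i | φ.eval I (Function.update (fun _ => ⟨0, i.pos⟩) x i)
      (setEnv I.n (fun (_ : β) _ => []))}).reverse ++ [] =
      ((bits (φ.output x I)).reverse).map some := by
    rw [hset, List.append_nil, syms, List.map_reverse]
    rfl
  rw [hbits] at h2
  obtain ⟨v₁, r₁⟩ := does_setup (α := α) (β := β) I none []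
  obtain ⟨v₂, r₂⟩ := h2 v₁ []
  obtain ⟨v₃, r₃⟩ := runs_emit I (fun _ : α => 0) (fun _ => 0) (fun (_ : β) _ => []) (fun _ => 0)
    (bits (φ.output x I)).reverse v₂ []
  obtain ⟨v₄, r₄⟩ := does_cleanup (α := α) (β := β) I v₃
    ((bits (φ.output x I)).reverse.reverse ++ [])
  refine ⟨v₄, ?_⟩
  have hout : (bits (φ.output x I)).reverse.reverse ++ [] =
      encodeOutput ⟨I.n, φ.output x I⟩ := by
    simp [encodeOutput]
  have hlen : (bits (φ.output x I)).length = I.n := by simp [bits]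
  rw [hout] at r₄ r₃
  refine (r₁.seq (r₂.seq (r₃.seq r₄))).mono ?_
  refine le_trans ?_ (eval_mono_nat _ (a := I.n) ?_)
  · simp [hlen]
    omega
  · rw [length_encodeInput]
    nlinarith

end TopLevel

end Monophonic

/-! ### Formulas for the pre-saturation and the saturation. -/

namespace Monophonic

/-- The vertex variables in the formulas for the saturation. -/
inductive VertexVar : Type
  | o
  | q
  | v
  | x
  | t
  | a
  | w
  | y
  | z
  | u
  | r
  deriving DecidableEq

instance : Fintype VertexVar :=
  ⟨{.o, .q, .v, .x, .t, .a, .w, .y, .z, .u, .r}, fun c => by cases c <;> decide⟩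

/-- The set variables in the formulas for the saturation. -/
inductive SetVar : Type
  | S
  | P
  | Q
  | D
  | Y
  | H
  | W
  | O
  | R
  deriving DecidableEq

instance : Fintype SetVar :=
  ⟨{.S, .P, .Q, .D, .Y, .H, .W, .O, .R}, fun c => by cases c <;> decide⟩

namespace Fml

section Derived

variable {α β : Type} [DecidableEq α] [DecidableEq β]

/-- Disjunction. -/
def or (φ ψ : Fml α β) : Fml α β := neg (and (neg φ) (neg ψ))

/-- Equality of vertices. -/
def eq (x y : α) : Fml α β := and (le x y) (le y x)

/-- The fixed point operator for a single set. -/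
def fixOne (b : β) (x : α) (φ χ : Fml α β) : Fml α β := fix b x φ (neg (le x x)) χ

variable {I : Input} {e : α → Fin I.n} {s : β → Set (Fin I.n) × Set (Fin I.n)}

theorem eval_neg {φ : Fml α β} : eval I (neg φ) e s ↔ ¬ eval I φ e s := Iff.rfl

theorem eval_and {φ ψ : Fml α β} : eval I (and φ ψ) e s ↔ eval I φ e s ∧ eval I ψ e s := Iff.rfl

theorem eval_or {φ ψ : Fml α β} : eval I (or φ ψ) e s ↔ eval I φ e s ∨ eval I ψ e s := by
  simp only [or, eval]
  tauto

theorem eval_eq {x y : α} : eval I (eq x y : Fml α β) e s ↔ e x = e y := by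
  simp only [eq, eval]
  exact le_antisymm_iff.symm

theorem eval_ex {x : α} {φ : Fml α β} :
    eval I (ex x φ) e s ↔ ∃ i, eval I φ (Function.update e x i) s := Iff.rfl

theorem eval_mem {i : Bool} {b : β} {x : α} :
    eval I (mem i b x : Fml α β) e s ↔ e x ∈ side i (s b) := Iff.rfl

theorem eval_edge {x y : α} :
    eval I (edge x y : Fml α β) e s ↔ I.graph.Adj (e x) (e y) := Iff.rfl

theorem eval_fixOne {b : β} {x : α} {φ χ : Fml α β} (f : Set (Fin I.n) → Set (Fin I.n))
    (hf : ∀ S i, eval I φ (Function.update e x i) (Function.update s b (S, ∅)) ↔ i ∈ f S) :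
    eval I (fixOne b x φ χ) e s ↔
      eval I χ e (Function.update s b (f^[2 * I.n] ∅, ∅)) := by
  have hiter : ∀ k, (fun S : Set (Fin I.n) × Set (Fin I.n) =>
        ({i | eval I φ (Function.update e x i) (Function.update s b S)},
          {i | eval I (neg (le x x)) (Function.update e x i) (Function.update s b S)}))^[k]
        (∅, ∅) = (f^[k] ∅, ∅) := by
    intro k
    induction k with
    | zero => rfl
    | succ k ih =>
      rw [Function.iterate_succ_apply', Function.iterate_succ_apply', ih]
      simp only [hf, Prod.mk.injEq]
      exact ⟨rfl, by simp [eval]⟩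
  rw [fixOne, eval, hiter]

/-- A fixed point whose body ignores the current set serves as a definition of a set. One round
suffices, and 2n > 0 because e x is a vertex. -/
theorem eval_fixOne_const {b : β} {x : α} {φ χ : Fml α β} (C : Set (Fin I.n))
    (hC : ∀ S i, eval I φ (Function.update e x i) (Function.update s b (S, ∅)) ↔ i ∈ C) :
    eval I (fixOne b x φ χ) e s ↔ eval I χ e (Function.update s b (C, ∅)) := by
  rw [eval_fixOne (fun _ => C) hC]
  obtain ⟨k, hk⟩ : ∃ k, 2 * I.n = k + 1 := ⟨2 * I.n - 1, by have := (e x).pos; omega⟩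
  rw [hk, Function.iterate_succ_apply']

end Derived

section Concrete

open VertexVar SetVar

/-- Membership in a set variable. -/
abbrev isIn (b : SetVar) (c : VertexVar) : Fml VertexVar SetVar := mem false b c

/-- Let `R` be the set of vertices that are reached from `y` by paths whose inner vertices are
neither in `C` nor adjacent to `z`. -/
def letReach (C : SetVar) (χ : Fml VertexVar SetVar) : Fml VertexVar SetVar :=
  fixOne R u (or (isIn R u) (or (edge y u) (ex r (and (isIn R r) (and (neg (isIn C r))
    (and (neg (edge r z)) (edge r u))))))) χ

/-- Let `C` be the convex hull of `X`. -/
def letHull (C X : SetVar) (χ : Fml VertexVar SetVar) : Fml VertexVar SetVar :=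
  fixOne C w (or (isIn X w) (or (isIn C w) (and (neg (isIn C w)) (ex y (ex z (and (isIn C y)
    (and (isIn C z) (and (neg (eq y z)) (and (neg (edge y z)) (and (edge z w)
      (letReach C (isIn R w)))))))))))) χ

/-- Let `O` be the pre-saturation of `p` with respect to `q`. -/
def letPreSat (p q : SetVar) (χ : Fml VertexVar SetVar) : Fml VertexVar SetVar :=
  fixOne D v
    (or
      (fixOne Y t (or (isIn q t) (eq t v)) (letHull H Y (ex a (and (isIn H a) (isIn p a)))))
      (fixOne W x
        (and (neg (isIn p x)) (and (neg (isIn q x))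
          (fixOne Y t (or (isIn p t) (eq t x)) (letHull H Y (isIn H v)))))
        (letHull H W (and (ex a (and (isIn H a) (isIn p a))) (ex a (and (isIn H a) (isIn q a)))))))
    (letHull O D χ)

/-- The formula that defines the pre-saturation. -/
def preSatFml : Fml VertexVar SetVar :=
  fixOne P v (inA v) (fixOne Q v (inB v) (letPreSat P Q (isIn O o)))

/-- Let `P` and `Q` be the unions of `A` and `B` with the components of `S`. -/
def letUnions (χ : Fml VertexVar SetVar) : Fml VertexVar SetVar :=
  fixOne P v (or (inA v) (mem false S v)) (fixOne Q v (or (inB v) (mem true S v)) χ)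

/-- The formula that defines the saturation. -/
def satFml : Fml VertexVar SetVar :=
  fix S q (letUnions (letPreSat P Q (isIn O q))) (letUnions (letPreSat Q P (isIn O q))) (isIn S o)

variable {I : Input} {e : VertexVar → Fin I.n} {s : SetVar → Set (Fin I.n) × Set (Fin I.n)}

theorem eval_letReach {C : SetVar} (hC : C ≠ R) {χ : Fml VertexVar SetVar} :
    eval I (letReach C χ) e s ↔ eval I χ e (Function.update s R
      ((reachStep I.graph (s C).1 (e y) (e z))^[2 * I.n] ∅, ∅)) := by
  refine eval_fixOne _ fun S i => ?_
  simp [eval_or, eval_and, eval_neg, eval_ex, eval_mem, eval_edge, side, reachStep, hC]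

theorem eval_letHull {C X : SetVar} (hC : C ≠ R) (hXC : X ≠ C) {χ : Fml VertexVar SetVar} :
    eval I (letHull C X χ) e s ↔
      eval I χ e (Function.update s C (hull I.graph (s X).1, ∅)) := by
  rw [← hullStep_iterate]
  refine eval_fixOne _ fun S i => ?_
  simp [eval_or, eval_and, eval_neg, eval_ex, eval_mem, eval_edge, eval_eq, eval_letReach hC, side,
    hullStep, hXC]

/-- The auxiliary variable D keeps a value C that is of no interest afterwards, hence the
existential statement. -/
theorem eval_letPreSat {p q : SetVar} (hp : p = P ∨ p = Q) (hq : q = P ∨ q = Q)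
    {χ : Fml VertexVar SetVar} :
    ∃ C, eval I (letPreSat p q χ) e s ↔ eval I χ e (Function.update (Function.update s D C) O
      (preSat I.graph (s p).1 (s q).1, ∅)) := by
  have hpne : p ≠ D ∧ p ≠ Y ∧ p ≠ H ∧ p ≠ W ∧ p ≠ R := by rcases hp with rfl | rfl <;> simp
  have hqne : q ≠ D ∧ q ≠ Y ∧ q ≠ H ∧ q ≠ W ∧ q ≠ R := by rcases hq with rfl | rfl <;> simp
  let C : Set (Fin I.n) := {c | (∃ d, d ∈ hull I.graph {k | k ∈ (s q).1 ∨ k = c} ∧ d ∈ (s p).1) ∨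
    (∃ d, d ∈ hull I.graph (witnesses I.graph (s p).1 (s q).1 c) ∧ d ∈ (s p).1) ∧
      ∃ d, d ∈ hull I.graph (witnesses I.graph (s p).1 (s q).1 c) ∧ d ∈ (s q).1}
  refine ⟨(C, ∅), (eval_fixOne_const C fun S i => ?_).trans ?_⟩
  · rw [eval_or]
    refine or_congr ?_ ?_
    · rw [eval_fixOne_const {k | k ∈ (s q).1 ∨ k = i}, eval_letHull (by simp) (by simp)]
      · simp [eval_ex, eval_and, eval_mem, side, hpne]
      · intro T j
        simp [eval_or, eval_mem, eval_eq, side, hqne]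
    · rw [eval_fixOne_const (witnesses I.graph (s p).1 (s q).1 i),
        eval_letHull (by simp) (by simp)]
      · simp [eval_ex, eval_and, eval_mem, side, hpne, hqne]
      · intro T j
        rw [eval_and, eval_and, eval_fixOne_const {k | k ∈ (s p).1 ∨ k = j},
          eval_letHull (by simp) (by simp)]
        · simp [eval_neg, eval_mem, side, hpne, hqne, witnesses]
        · intro T' k
          simp [eval_or, eval_mem, eval_eq, side, hpne]
  · rw [eval_letHull (by simp) (by simp), preSat_eq]
    simp [C]

theorem eval_letUnions {χ : Fml VertexVar SetVar} :
    eval I (letUnions χ) e s ↔ eval I χ e (Function.update (Function.update s P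
      (I.A ∪ (s S).1, ∅)) Q (I.B ∪ (s S).2, ∅)) := by
  refine (eval_fixOne_const (I.A ∪ (s S).1) fun T i => ?_).trans
    (eval_fixOne_const (I.B ∪ (s S).2) fun T i => ?_)
  · simp [eval_or, eval, side]
  · simp [eval_or, eval, side]

theorem output_preSatFml (I : Input) :
    preSatFml.output o I = preSat I.graph I.A I.B := by
  ext i
  simp only [output, preSatFml, Set.mem_ofPred_eq]
  rw [eval_fixOne_const I.A (fun T j => by simp [eval]),
    eval_fixOne_const I.B (fun T j => by simp [eval])]
  obtain ⟨C, hC⟩ := eval_letPreSat (I := I) (p := P) (q := Q) (by simp) (by simp)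
    (χ := isIn O o) (e := Function.update (fun _ => ⟨0, i.pos⟩) o i)
    (s := Function.update (Function.update (fun _ => (∅, ∅)) P (I.A, ∅)) Q (I.B, ∅))
  rw [hC]
  simp [eval_mem, side]

theorem output_satFml (I : Input) :
    satFml.output o I = saturation I.graph I.A I.B := by
  ext i
  rw [saturation_eq]
  simp only [output, satFml, Set.mem_ofPred_eq, eval, Function.update_self, side, cond_false]
  have hstep : (fun T : Set (Fin I.n) × Set (Fin I.n) =>
      ({j | eval I (letUnions (letPreSat P Q (isIn O q)))
        (Function.update (Function.update (fun _ => ⟨0, i.pos⟩) o i) q j)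
        (Function.update (fun _ => (∅, ∅)) S T)},
      {j | eval I (letUnions (letPreSat Q P (isIn O q)))
        (Function.update (Function.update (fun _ => ⟨0, i.pos⟩) o i) q j)
        (Function.update (fun _ => (∅, ∅)) S T)})) = satStep I.graph I.A I.B := by
    funext T
    refine Prod.ext ?_ ?_ <;>
    · ext j
      simp only [Set.mem_ofPred_eq, eval_letUnions]
      obtain ⟨C, hC⟩ := eval_letPreSat (I := I) (p := P) (q := Q) (by simp) (by simp)
        (χ := isIn O q) (e := Function.update (Function.update (fun _ => ⟨0, i.pos⟩) o i) q j)
        (s := Function.update (Function.update (Function.update (fun _ => (∅, ∅)) S T) P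
          (I.A ∪ (Function.update (fun _ => ((∅ : Set (Fin I.n)), (∅ : Set (Fin I.n)))) S T S).1,
            ∅)) Q (I.B ∪ (Function.update (fun _ => ((∅ : Set (Fin I.n)), (∅ : Set (Fin I.n))))
              S T S).2, ∅))
      obtain ⟨C', hC'⟩ := eval_letPreSat (I := I) (p := Q) (q := P) (by simp) (by simp)
        (χ := isIn O q) (e := Function.update (Function.update (fun _ => ⟨0, i.pos⟩) o i) q j)
        (s := Function.update (Function.update (Function.update (fun _ => (∅, ∅)) S T) P
          (I.A ∪ (Function.update (fun _ => ((∅ : Set (Fin I.n)), (∅ : Set (Fin I.n)))) S T S).1,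
            ∅)) Q (I.B ∪ (Function.update (fun _ => ((∅ : Set (Fin I.n)), (∅ : Set (Fin I.n))))
              S T S).2, ∅))
      -- The first alternative is for the component of A, the second for that of B with the roles of
      -- P and Q exchanged.
      first
        | rw [hC]; simp [eval_mem, side, satStep]
        | rw [hC']; simp [eval_mem, side, satStep]
  rw [hstep]

end Concrete

end Fml

theorem polyTimeComputable_preSatFun : PolyTimeComputable preSatFun := by
  have h := Fml.preSatFml.polyTimeComputable (by decide) .o (by decide)
  simpa only [Fml.output_preSatFml] using! h

theorem polyTimeComputable_saturationFun : PolyTimeComputable saturationFun := by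
  have h := Fml.satFml.polyTimeComputable (by decide) .o (by decide)
  simpa only [Fml.output_satFml] using! h

end Monophonic
theorem mainTheorem7 :
    -- pre-saturation and saturation are computable in polynomial time
    (Monophonic.PolyTimeComputable Monophonic.preSatFun ∧
      Monophonic.PolyTimeComputable Monophonic.saturationFun) ∧
    -- minimal forbidden sets have at most four elements
    (∀ (V : Type*) [Finite V] (G : SimpleGraph V) (A B : Set V),
      ∀ X ∈ Monophonic.minForbidden G A B, X.ncard ≤ 4) ∧
    -- the Carathéodory number is at most two, and equal to two if `G` is connected, not complete
    (∀ (V : Type*) [Finite V] (G : SimpleGraph V),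
      Monophonic.CaratheodoryBound G 2 ∧
        (G.Connected → G ≠ ⊤ → Monophonic.IsCaratheodoryNumber G 2)) := by
  exact ⟨⟨Monophonic.polyTimeComputable_preSatFun, Monophonic.polyTimeComputable_saturationFun⟩,
    fun V _ G A B X hX => Monophonic.ncard_le_four_of_mem_minForbidden G A B X hX,
    fun V _ G => ⟨Monophonic.caratheodoryBound_two G, Monophonic.isCaratheodoryNumber_two⟩⟩
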